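/- Let $\mathbb{T}=\mathbb{R}/2\pi\mathbb{Z}$ and let $v:\mathbb{T}\to\mathbb{R}$ be a $C^2$ function with only finitely many critical points, all of them simple, i.e. $v''(y)\neq 0$ whenever $v'(y)=0$. Then there are constants $C>0$ and $C_{\mathrm{ed}}>0$, depending only on $v$, such that the following holds. Let $0<\nu\le 1$, let $k$ be a nonzero integer, and let $s\in[0,\infty)$, $\beta\in[\nu/|k|,1]$, $\ell\in[2,4]$ and $0<T<\infty$. Put $$w_\nu(t)=(1+\nu^s t)^{-1},\qquad t^*_{\nu,k}=\frac{1}{\nu^s}\left(\frac{|k|^{1/2}C\beta^{3/2}}{\nu^{1/2}}-1\right),$$ $$L(t)=\begin{cases} C^2\beta^2, & t\le t^*_{\nu,k},\\[2pt] \dfrac{\nu}{|k|\beta}\,w_\nu(t)^{-2}, & t\ge t^*_{\nu,k},\end{cases}\qquad U(t)=w_\nu(t)^{-\ell}$$ (the two branches of $L$ agree at $t^*_{\nu,k}$). Let $\xi\in L^2([0,T])$ be real-valued with $L(t)\le\xi(t)\le U(t)$ for all $t\in[0,T]$, let $\hat\Theta_0\in L^2(\mathbb{T};\mathbb{C})$,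 and let $\hat\Theta\in C([0,T];L^2(\mathbb{T}))\cap L^2(0,T;H^1(\mathbb{T}))$ be a weak solution of $$\partial_t\hat\Theta+\xi(t)v(y)\,ik\,\hat\Theta=\nu(-k^2+\partial_y^2)\hat\Theta\quad\text{on }\mathbb{T}\times[0,T],\qquad \hat\Theta(0)=\hat\Theta_0 .$$ Then, for every $t\in[0,T]$, $$\|\hat\Theta(t)\|_{L^2_y}^2\le C_{\mathrm{ed}}\left(1+\left(\frac{|k|}{\nu}\right)^{1/2}\right)\exp\left(-\frac14(\beta\nu|k|)^{1/2}\int_0^t\xi(\tau)^{1/2}w_\nu(\tau)\,d\tau-2\nu k^2t\right)\|\hat\Theta_0\|_{L^2_y}^2 .$$ -/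

import Mathlib

open MeasureTheory Set
open scoped ContDiff Real

noncomputable section

/-- The torus `ℝ / 2πℤ`. Its `volume` is Lebesgue measure, of total mass `2π`. -/
abbrev Torus : Type := AddCircle (2 * π)

instance torusPeriodPos : Fact (0 < 2 * π) := ⟨Real.two_pi_pos⟩

/-- Complex-valued `L²` on the torus. -/
abbrev TorusL2 : Type := Lp ℂ 2 (volume : Measure Torus)

/-- A function on the torus is `C^n` when its periodic lift to the real line is. -/
def TorusContDiff {F : Type*} [NormedAddCommGroup F] [NormedSpace ℝ F]
    (n : WithTop ℕ∞) (f : Torus → F) : Prop :=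
  ContDiff ℝ n (fun x : ℝ => f (x : Torus))

/-- The derivative of a function on the torus. -/
def torusDeriv {F : Type*} [NormedAddCommGroup F] [NormedSpace ℝ F]
    (f : Torus → F) (y : Torus) : F :=
  deriv (fun h : ℝ => f (y + (h : Torus))) 0

/-- A `C²` shear profile with finitely many critical points, all of them simple. -/
structure IsSimpleShear (v : Torus → ℝ) : Prop where
  contDiff : TorusContDiff 2 v
  finite_critical : {y : Torus | torusDeriv v y = 0}.Finite
  simple_critical : ∀ y : Torus, torusDeriv v y = 0 → torusDeriv (torusDeriv v) y ≠ 0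

/-- `g ∈ L²` is the weak derivative of `f ∈ L²` on the torus. -/
def IsWeakDeriv (f g : TorusL2) : Prop :=
  ∀ φ : Torus → ℂ, TorusContDiff ∞ φ →
    (∫ y : Torus, f y * torusDeriv φ y) = -(∫ y : Torus, g y * φ y)

/-- Weak solutions on `[0, T]` of
`∂ₜ Θ + ξ(t) v(y) i k Θ = ν (-k² + ∂_y²) Θ`, `Θ(0) = Θ₀`, in the class
`C([0, T]; L²) ∩ L²(0, T; H¹)`. The equation is tested against smooth functions of `y` and
integrated in time; `D` is the weak `y`-derivative of `Θ`. -/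
structure IsWeakSolution (ν : ℝ) (k : ℤ) (T : ℝ) (ξ : ℝ → ℝ) (v : Torus → ℝ)
    (Θ₀ : TorusL2) (Θ : ℝ → TorusL2) : Prop where
  continuousOn : ContinuousOn Θ (Icc 0 T)
  initial : Θ 0 = Θ₀
  equation : ∃ D : ℝ → TorusL2,
    MemLp D 2 (volume.restrict (Icc 0 T)) ∧
    (∀ᵐ t ∂(volume.restrict (Icc 0 T)), IsWeakDeriv (Θ t) (D t)) ∧
    ∀ φ : Torus → ℂ, TorusContDiff ∞ φ → ∀ t ∈ Icc 0 T,
      (∫ y : Torus, Θ t y * φ y) = (∫ y : Torus, Θ₀ y * φ y) +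
        ∫ τ in (0 : ℝ)..t,
          (-(Complex.I * (k : ℂ) * (ξ τ : ℂ) * (∫ y : Torus, (v y : ℂ) * Θ τ y * φ y))
            - (ν : ℂ) * (k : ℂ) ^ 2 * (∫ y : Torus, Θ τ y * φ y)
            - (ν : ℂ) * (∫ y : Torus, D τ y * torusDeriv φ y))

/-- The weight `w_ν(t) = (1 + ν^s t)⁻¹`. -/
def weight (ν s t : ℝ) : ℝ := (1 + ν ^ s * t)⁻¹

/-- The switching time `t*`. -/
def switchTime (C β ν : ℝ) (k : ℤ) (s : ℝ) : ℝ :=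
  1 / ν ^ s * (|(k : ℝ)| ^ (1 / 2 : ℝ) * C * β ^ (3 / 2 : ℝ) / ν ^ (1 / 2 : ℝ) - 1)

/-- The lower bound `L(t)`. Its two branches agree at `t = t*`. -/
def lowerBound (C β ν : ℝ) (k : ℤ) (s t : ℝ) : ℝ :=
  if t ≤ switchTime C β ν k s then C ^ 2 * β ^ 2
  else ν / (|(k : ℝ)| * β) * weight ν s t ^ (-2 : ℝ)

/-- The upper bound `U(t)`. -/
def upperBound (ν s ℓ t : ℝ) : ℝ := weight ν s t ^ (-ℓ)

end

/-! The method is hypocoercivity with time-dependent weights. Write q = 1 + ν^s t, κ = |k|, and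
consider Φ = ½‖Θ‖² + ½a‖∂Θ‖² + b k Im⟨v'Θ, ∂Θ⟩ + ½c k²‖v'Θ‖². Because [∂, v] = v', differentiating
the cross term produces the dissipation −b k²ξ‖v'Θ‖², which the plain energy balance does not see.
Together with ν‖∂Θ‖² it controls ‖Θ‖² through the spectral gap inequality `exists_interpolation`.
With a, b, c the powers of q in `gradWeight`, `crossWeight`, `shearWeight`, this gives Φ' ≤ −(2νk² +
r/4)Φ with r = (βνκ)^{1/2} ξ^{1/2}/q (`hypoRate_le`, `Admissible.weight_conditions`,
`Admissible.coercivity`). The bound ξ ≤ q^ℓ tames the growth of ‖∂Θ‖ caused by the shear, the branch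
νq²/(κβ) of L makes the spectral gap available at the required scale, and the branch C²β² makes the
terms containing v'' perturbative. The weights decrease in time, so their derivatives have a
favourable sign.

The data lie only in L², so Φ need not be finite at time zero. The energy identity bounds ∫ν‖∂Θ‖²,
and r a ≤ ν while c κ² ≲ (κ/ν)^{1/2}. Averaging Φ against r dt over the initial layer ∫r ≤ 1
therefore costs only (1 + (κ/ν)^{1/2})‖Θ₀‖², which is the prefactor of the theorem
(`decay_of_averaging`).

A weak solution is too rough for Φ to be differentiated. The estimates are made for the Fourier
truncations P_SΘ of the given solution, which are Lipschitz in time (`IsWeakSolution.proj_eq`).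
Truncation does not commute with v, and the resulting errors are collected in `forcing`. Their time
integral tends to 0 as S exhausts ℤ because Θ ∈ C_tL² ∩ L²_tH¹ (`tendsto_integral_forcing`), so the
constants multiplying them need only be uniform in S. -/

open Filter Topology ComplexConjugate

/-! ### Multiplication by continuous real functions as self-adjoint operators on L². -/

section Multiplication

lemma memLp_mul_torus (h : C(Torus, ℝ)) (f : TorusL2) :
    MemLp (fun y : Torus => (h y : ℂ) * f y) 2 (volume : Measure Torus) := by
  refine MemLp.of_le_mul (c := ‖h‖) (Lp.memLp f) ?_ (Eventually.of_forall fun y => ?_)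
  · exact (Complex.continuous_ofReal.comp h.continuous).aestronglyMeasurable.mul
      (Lp.aestronglyMeasurable f)
  · rw [norm_mul, Complex.norm_real]
    gcongr
    exact h.norm_coe_le_norm y

/-- Multiplication by a real continuous function on `L²` of the torus. -/
noncomputable def mulLp (h : C(Torus, ℝ)) : TorusL2 →L[ℂ] TorusL2 :=
  LinearMap.mkContinuous
    { toFun := fun f => (memLp_mul_torus h f).toLp _
      map_add' := fun f g => by
        rw [← MemLp.toLp_add]
        apply MemLp.toLp_congr
        filter_upwards [Lp.coeFn_add f g] with y hy
        simp only [Pi.add_apply] at hy ⊢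
        rw [hy, mul_add]
      map_smul' := fun c f => by
        rw [RingHom.id_apply, ← MemLp.toLp_const_smul]
        apply MemLp.toLp_congr
        filter_upwards [Lp.coeFn_smul c f] with y hy
        simp only [Pi.smul_apply, smul_eq_mul] at hy ⊢
        rw [hy]; ring } ‖h‖ (fun f => by
      apply Lp.norm_le_mul_norm_of_ae_le_mul
      filter_upwards [MemLp.coeFn_toLp (memLp_mul_torus h f)] with y hy
      simp only [LinearMap.coe_mk, AddHom.coe_mk]
      rw [hy, norm_mul, Complex.norm_real]
      gcongr
      exact h.norm_coe_le_norm y)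

lemma coeFn_mulLp (h : C(Torus, ℝ)) (f : TorusL2) :
    (mulLp h f : Torus → ℂ) =ᵐ[volume] fun y => (h y : ℂ) * f y :=
  MemLp.coeFn_toLp (memLp_mul_torus h f)

lemma norm_mulLp_le (h : C(Torus, ℝ)) (f : TorusL2) : ‖mulLp h f‖ ≤ ‖h‖ * ‖f‖ :=
  (mulLp h).le_of_opNorm_le (LinearMap.mkContinuous_norm_le _ (norm_nonneg _) _) f

lemma inner_mulLp_right (h : C(Torus, ℝ)) (f g : TorusL2) :
    inner ℂ f (mulLp h g) = ∫ y : Torus, (h y : ℂ) * (conj (f y) * g y) := by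
  rw [L2.inner_def]
  apply integral_congr_ae
  filter_upwards [coeFn_mulLp h g] with y hy
  rw [hy, RCLike.inner_apply']
  ring

lemma inner_mulLp_left (h : C(Torus, ℝ)) (f g : TorusL2) :
    inner ℂ (mulLp h f) g = inner ℂ f (mulLp h g) := by
  rw [inner_mulLp_right, L2.inner_def]
  apply integral_congr_ae
  filter_upwards [coeFn_mulLp h f] with y hy
  rw [hy, RCLike.inner_apply', map_mul, Complex.conj_ofReal]
  ring

lemma mulLp_mulLp (h g : C(Torus, ℝ)) (f : TorusL2) :
    mulLp h (mulLp g f) = mulLp (h * g) f := by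
  apply Lp.ext
  filter_upwards [coeFn_mulLp h (mulLp g f), coeFn_mulLp g f, coeFn_mulLp (h * g) f]
    with y h1 h2 h3
  rw [h1, h2, h3, ContinuousMap.mul_apply]
  push_cast
  ring

lemma mulLp_comm (h g : C(Torus, ℝ)) (f : TorusL2) :
    mulLp h (mulLp g f) = mulLp g (mulLp h f) := by
  rw [mulLp_mulLp, mulLp_mulLp, mul_comm h g]

lemma mulLp_add (h g : C(Torus, ℝ)) (f : TorusL2) :
    mulLp (h + g) f = mulLp h f + mulLp g f := by
  apply Lp.ext
  filter_upwards [coeFn_mulLp h f, coeFn_mulLp g f, coeFn_mulLp (h + g) f,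
    Lp.coeFn_add (mulLp h f) (mulLp g f)] with y h1 h2 h3 h4
  rw [h3, h4, Pi.add_apply, h1, h2, ContinuousMap.add_apply]
  push_cast
  ring

lemma mulLp_smul (c : ℝ) (h : C(Torus, ℝ)) (f : TorusL2) :
    mulLp (c • h) f = (c : ℂ) • mulLp h f := by
  apply Lp.ext
  filter_upwards [coeFn_mulLp h f, coeFn_mulLp (c • h) f,
    Lp.coeFn_smul (c : ℂ) (mulLp h f)] with y h1 h2 h3
  rw [h2, h3, Pi.smul_apply, h1, ContinuousMap.smul_apply]
  simp only [smul_eq_mul]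
  push_cast
  ring

lemma mulLp_one (f : TorusL2) : mulLp 1 f = f := by
  apply Lp.ext
  filter_upwards [coeFn_mulLp 1 f] with y h1
  rw [h1]; simp

lemma re_inner_mulLp_nonneg {h : C(Torus, ℝ)} (hh : ∀ y, 0 ≤ h y) (f : TorusL2) :
    0 ≤ (inner ℂ f (mulLp h f)).re := by
  rw [inner_mulLp_right]
  have : (fun y : Torus => (h y : ℂ) * (conj (f y) * f y))
      = fun y : Torus => ((h y * ‖f y‖ ^ 2 : ℝ) : ℂ) := by
    funext y
    rw [mul_comm (conj (f y)), Complex.mul_conj, Complex.normSq_eq_norm_sq]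
    push_cast; ring
  rw [this, integral_complex_ofReal, Complex.ofReal_re]
  exact integral_nonneg fun y => mul_nonneg (hh y) (by positivity)

end Multiplication

/-! ### Fourier modes, truncation, and truncated differentiation. -/

section FourierBasis

/-- The orthonormal Fourier modes in `L²` of the torus with Lebesgue measure. -/
noncomputable def torusMode (n : ℤ) : TorusL2 :=
  ((Real.sqrt (2 * π))⁻¹ : ℂ) • ContinuousMap.toLp (E := ℂ) 2 volume ℂ (fourier n)

lemma coeFn_torusMode (n : ℤ) :
    (torusMode n : Torus → ℂ) =ᵐ[volume] fun y => ((Real.sqrt (2 * π))⁻¹ : ℂ) * fourier n y := by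
  filter_upwards [Lp.coeFn_smul ((Real.sqrt (2 * π))⁻¹ : ℂ)
    (ContinuousMap.toLp (E := ℂ) 2 (volume : Measure Torus) ℂ (fourier n)),
    ContinuousMap.coeFn_toLp (𝕜 := ℂ) (p := 2) (volume : Measure Torus) (fourier n : C(Torus, ℂ))]
    with y h1 h2
  rw [torusMode, h1, Pi.smul_apply, h2, smul_eq_mul]

lemma integral_fourier_torus (j : ℤ) :
    ∫ y : Torus, (fourier j y : ℂ) = if j = 0 then (2 * π : ℂ) else 0 := by
  split_ifs with h
  · subst h
    simp only [fourier_zero]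
    rw [integral_const]
    simp [measureReal_def, AddCircle.measure_univ, Real.pi_pos.le]
  -- Translation by half a period of the mode changes its sign, so the integral equals its own
  -- negative.
  · exact integral_eq_zero_of_add_right_eq_neg (μ := (volume : Measure Torus))
      (fourier_add_half_inv_index h torusPeriodPos.elim)

lemma sqrt_two_pi_inv_mul_self :
    ((Real.sqrt (2 * π))⁻¹ : ℂ) * ((Real.sqrt (2 * π))⁻¹ : ℂ) * (2 * π) = 1 := by
  have h : (Real.sqrt (2 * π)) * (Real.sqrt (2 * π)) = 2 * π :=
    Real.mul_self_sqrt Real.two_pi_pos.le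
  have h' : ((Real.sqrt (2 * π) : ℝ) : ℂ) * (Real.sqrt (2 * π) : ℝ) = 2 * π := by
    rw [← Complex.ofReal_mul, h]; push_cast; ring
  rw [← mul_inv, h']
  apply inv_mul_cancel₀
  exact_mod_cast Real.two_pi_pos.ne'

lemma inner_torusMode (n : ℤ) (f : TorusL2) :
    inner ℂ (torusMode n) f =
      ((Real.sqrt (2 * π))⁻¹ : ℂ) * ∫ y : Torus, f y * fourier (-n) y := by
  rw [L2.inner_def, ← integral_const_mul]
  apply integral_congr_ae
  filter_upwards [coeFn_torusMode n] with y hy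
  rw [RCLike.inner_apply', hy, map_mul, fourier_neg, ← Complex.ofReal_inv, Complex.conj_ofReal]
  ring

lemma inner_torusMode_mulLp (h : C(Torus, ℝ)) (m n : ℤ) :
    inner ℂ (torusMode m) (mulLp h (torusMode n)) =
      ((Real.sqrt (2 * π))⁻¹ : ℂ) * ((Real.sqrt (2 * π))⁻¹ : ℂ) *
        ∫ y : Torus, (h y : ℂ) * fourier (n - m) y := by
  rw [inner_torusMode, mul_assoc, ← integral_const_mul (L := ℂ) ((Real.sqrt (2 * π))⁻¹ : ℂ)
    (fun y : Torus => (h y : ℂ) * fourier (n - m) y)]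
  congr 1
  apply integral_congr_ae
  filter_upwards [coeFn_mulLp h (torusMode n), coeFn_torusMode n] with y h1 h2
  rw [h1, h2, sub_eq_add_neg, fourier_add]
  ring

lemma orthonormal_torusMode : Orthonormal ℂ torusMode := by
  rw [orthonormal_iff_ite]
  intro i j
  have := inner_torusMode_mulLp 1 i j
  rw [mulLp_one] at this
  rw [this]
  simp only [ContinuousMap.one_apply, Complex.ofReal_one, one_mul]
  rw [integral_fourier_torus]
  split_ifs with h1 h2 h2
  · exact sqrt_two_pi_inv_mul_self
  · omega
  · omega
  · simp

lemma span_torusMode_closure_eq_top :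
    (Submodule.span ℂ (range torusMode)).topologicalClosure = ⊤ := by
  have h0 : (Submodule.span ℂ (range fun n : ℤ =>
      ContinuousMap.toLp (E := ℂ) 2 (volume : Measure Torus) ℂ (fourier n))).topologicalClosure
        = ⊤ := by
    convert! (ContinuousMap.toLp_denseRange ℂ (volume : Measure Torus) ℂ
      (p := 2) (by simp)).topologicalClosure_map_submodule span_fourier_closure_eq_top
    rw [Submodule.map_span, range_comp']
    simp only [ContinuousLinearMap.coe_coe]
  rw [eq_top_iff, ← h0]
  apply Submodule.topologicalClosure_mono
  rw [Submodule.span_le]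
  rintro _ ⟨n, rfl⟩
  have hne : ((Real.sqrt (2 * π))⁻¹ : ℂ) ≠ 0 := by
    intro h
    have := sqrt_two_pi_inv_mul_self
    rw [h] at this
    simp at this
  have : ContinuousMap.toLp (E := ℂ) 2 (volume : Measure Torus) ℂ (fourier n)
      = ((Real.sqrt (2 * π))⁻¹ : ℂ)⁻¹ • torusMode n := by
    rw [torusMode, smul_smul, inv_mul_cancel₀ hne, one_smul]
  simp only [this]
  exact Submodule.smul_mem _ _ (Submodule.subset_span ⟨n, rfl⟩)

/-- The Fourier Hilbert basis of `L²` of the torus with Lebesgue measure. -/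
noncomputable def torusBasis : HilbertBasis ℤ ℂ TorusL2 :=
  HilbertBasis.mk orthonormal_torusMode span_torusMode_closure_eq_top.ge

lemma coe_torusBasis : ⇑torusBasis = torusMode := HilbertBasis.coe_mk _ _

/-- The Fourier coefficient functional. -/
noncomputable def modeCoeff (n : ℤ) : TorusL2 →L[ℂ] ℂ := innerSL ℂ (torusMode n)

lemma modeCoeff_apply (n : ℤ) (f : TorusL2) : modeCoeff n f = inner ℂ (torusMode n) f := rfl

lemma modeCoeff_torusMode (m n : ℤ) : modeCoeff m (torusMode n) = if m = n then 1 else 0 := by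
  rw [modeCoeff_apply]
  exact orthonormal_iff_ite.mp orthonormal_torusMode m n

/-- Fourier truncation to the modes in `S`. -/
noncomputable def proj (S : Finset ℤ) : TorusL2 →L[ℂ] TorusL2 :=
  ∑ n ∈ S, (modeCoeff n).smulRight (torusMode n)

/-- The derivative of the Fourier truncation. -/
noncomputable def der (S : Finset ℤ) : TorusL2 →L[ℂ] TorusL2 :=
  ∑ n ∈ S, (Complex.I * n) • (modeCoeff n).smulRight (torusMode n)

lemma proj_apply (S : Finset ℤ) (f : TorusL2) :
    proj S f = ∑ n ∈ S, modeCoeff n f • torusMode n := by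
  simp [proj]

lemma der_apply (S : Finset ℤ) (f : TorusL2) :
    der S f = ∑ n ∈ S, (Complex.I * n * modeCoeff n f) • torusMode n := by
  simp [der, mul_smul]

lemma modeCoeff_proj (S : Finset ℤ) (m : ℤ) (f : TorusL2) :
    modeCoeff m (proj S f) = if m ∈ S then modeCoeff m f else 0 := by
  simp [proj_apply, modeCoeff_torusMode]

lemma modeCoeff_der (S : Finset ℤ) (m : ℤ) (f : TorusL2) :
    modeCoeff m (der S f) = if m ∈ S then Complex.I * m * modeCoeff m f else 0 := by
  simp [der_apply, modeCoeff_torusMode]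

lemma proj_congr {S : Finset ℤ} {f g : TorusL2} (h : ∀ n ∈ S, modeCoeff n f = modeCoeff n g) :
    proj S f = proj S g := by
  rw [proj_apply, proj_apply]
  exact Finset.sum_congr rfl fun n hn => by rw [h n hn]

lemma der_eq_proj {S : Finset ℤ} {f g : TorusL2}
    (h : ∀ n ∈ S, Complex.I * n * modeCoeff n f = modeCoeff n g) : der S f = proj S g := by
  rw [proj_apply, der_apply]
  exact Finset.sum_congr rfl fun n hn => by rw [h n hn]

lemma proj_proj (S : Finset ℤ) (f : TorusL2) : proj S (proj S f) = proj S f :=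
  proj_congr fun n hn => by rw [modeCoeff_proj, if_pos hn]

lemma proj_der (S : Finset ℤ) (f : TorusL2) : proj S (der S f) = der S f :=
  (der_eq_proj fun n hn => by rw [modeCoeff_der, if_pos hn]).symm

lemma der_proj (S : Finset ℤ) (f : TorusL2) : der S (proj S f) = der S f := by
  rw [← proj_der S f]
  exact der_eq_proj fun n hn => by rw [modeCoeff_proj, if_pos hn, modeCoeff_der, if_pos hn]

lemma inner_proj_left (S : Finset ℤ) (f g : TorusL2) :
    inner ℂ (proj S f) g = inner ℂ f (proj S g) := by
  rw [proj_apply, proj_apply, sum_inner, inner_sum]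
  refine Finset.sum_congr rfl fun n _ => ?_
  rw [inner_smul_left, inner_smul_right, modeCoeff_apply, modeCoeff_apply, inner_conj_symm]
  ring

lemma inner_der_left (S : Finset ℤ) (f g : TorusL2) :
    inner ℂ (der S f) g = -inner ℂ f (der S g) := by
  rw [der_apply, der_apply, sum_inner, inner_sum, ← Finset.sum_neg_distrib]
  refine Finset.sum_congr rfl fun n _ => ?_
  rw [inner_smul_left, inner_smul_right, modeCoeff_apply, modeCoeff_apply]
  simp only [map_mul, Complex.conj_I, inner_conj_symm, map_intCast]
  ring

lemma norm_proj_le (S : Finset ℤ) (f : TorusL2) : ‖proj S f‖ ≤ ‖f‖ := by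
  have h1 : ‖proj S f‖ ^ 2 ≤ ‖proj S f‖ * ‖f‖ := by
    rw [← inner_self_eq_norm_sq (𝕜 := ℂ), inner_proj_left, proj_proj, ← inner_proj_left]
    exact (RCLike.re_le_norm _).trans (norm_inner_le_norm _ _)
  by_contra! h
  have h2 := norm_nonneg f
  nlinarith

lemma tendsto_proj (f : TorusL2) : Tendsto (fun S => proj S f) atTop (𝓝 f) := by
  have := torusBasis.hasSum_repr f
  rw [HasSum] at this
  simp only [SummationFilter.unconditional_filter] at this
  refine this.congr fun S => ?_
  rw [proj_apply]
  refine Finset.sum_congr rfl fun n _ => ?_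
  rw [HilbertBasis.repr_apply_apply, coe_torusBasis, modeCoeff_apply]

end FourierBasis

/-! ### The Leibniz rule seen through Fourier truncations. -/

section Leibniz

/-- `h'` is the continuous derivative of `h` on the torus. -/
def HasTorusDeriv (h h' : C(Torus, ℝ)) : Prop :=
  ∀ x : ℝ, HasDerivAt (fun x : ℝ => h (x : Torus)) (h' (x : Torus)) x

lemma HasTorusDeriv.mul {h h' g g' : C(Torus, ℝ)} (H : HasTorusDeriv h h')
    (G : HasTorusDeriv g g') : HasTorusDeriv (h * g) (h' * g + h * g') := fun x => by
  exact (H x).mul (G x)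

lemma hasDerivAt_fourier_torus (n : ℤ) (x : ℝ) :
    HasDerivAt (fun y : ℝ => (fourier n (y : Torus) : ℂ))
      (Complex.I * n * fourier n (x : Torus)) x := by
  convert! hasDerivAt_fourier (2 * π) n x using 1
  have : (π : ℂ) ≠ 0 := by exact_mod_cast Real.pi_ne_zero
  push_cast
  field_simp

/-- Integration by parts over one period; the boundary terms cancel by periodicity. -/
lemma HasTorusDeriv.integral_mul_fourier {h h' : C(Torus, ℝ)} (H : HasTorusDeriv h h') (j : ℤ) :
    ∫ y : Torus, (h' y : ℂ) * fourier j y =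
      -(Complex.I * j * ∫ y : Torus, (h y : ℂ) * fourier j y) := by
  have hd : ∀ x : ℝ, HasDerivAt (fun x : ℝ => (h (x : Torus) : ℂ) * fourier j (x : Torus))
      ((h' (x : Torus) : ℂ) * fourier j (x : Torus)
        + (h (x : Torus) : ℂ) * (Complex.I * j * fourier j (x : Torus))) x := fun x =>
    (H x).ofReal_comp.mul (hasDerivAt_fourier_torus j x)
  have c0 : Continuous fun x : ℝ => (x : Torus) := AddCircle.continuous_mk' _
  have c1 : Continuous fun y : Torus => (h' y : ℂ) * fourier j y := by fun_prop
  have c2 : Continuous fun y : Torus => (h y : ℂ) * (Complex.I * j * fourier j y) := by fun_prop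
  have key := intervalIntegral.integral_eq_sub_of_hasDerivAt (a := 0) (b := 0 + 2 * π)
    (fun x _ => hd x) (((c1.comp c0).add (c2.comp c0)).intervalIntegrable _ _)
  have e0 : ((0 + 2 * π : ℝ) : Torus) = ((0 : ℝ) : Torus) := by
    rw [zero_add, AddCircle.coe_period, AddCircle.coe_zero]
  simp only [e0, sub_self] at key
  have i1 := (c1.comp c0).intervalIntegrable (μ := volume) 0 (0 + 2 * π)
  have i2 := (c2.comp c0).intervalIntegrable (μ := volume) 0 (0 + 2 * π)
  have key2 := (intervalIntegral.integral_add i1 i2).symm.trans key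
  simp only [Function.comp_def] at key2
  rw [AddCircle.intervalIntegral_preimage (2 * π) 0 (fun y : Torus => (h' y : ℂ) * fourier j y),
    AddCircle.intervalIntegral_preimage (2 * π) 0
      (fun y : Torus => (h y : ℂ) * (Complex.I * j * fourier j y))] at key2
  rw [eq_neg_of_add_eq_zero_left key2, ← integral_const_mul]
  congr 2
  funext y
  ring

lemma HasTorusDeriv.modeCoeff_mulLp_torusMode {h h' : C(Torus, ℝ)} (H : HasTorusDeriv h h')
    (m n : ℤ) :
    Complex.I * m * modeCoeff m (mulLp h (torusMode n)) =
      modeCoeff m (mulLp h' (torusMode n)) +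
        Complex.I * n * modeCoeff m (mulLp h (torusMode n)) := by
  simp only [modeCoeff_apply, inner_torusMode_mulLp]
  rw [H.integral_mul_fourier (n - m)]
  push_cast
  ring

/-- Leibniz rule for truncations. -/
lemma HasTorusDeriv.der_mulLp_proj {h h' : C(Torus, ℝ)} (H : HasTorusDeriv h h')
    (S S' : Finset ℤ) (f : TorusL2) :
    der S (mulLp h (proj S' f)) = proj S (mulLp h' (proj S' f) + mulLp h (der S' f)) := by
  refine der_eq_proj fun m _ => ?_
  rw [proj_apply, der_apply]
  simp only [map_sum, map_smul, map_add, smul_eq_mul]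
  rw [Finset.mul_sum, ← Finset.sum_add_distrib]
  refine Finset.sum_congr rfl fun n _ => ?_
  have := H.modeCoeff_mulLp_torusMode m n
  linear_combination (modeCoeff n f) * this

/-- Leibniz rule for an `H¹` function, whose derivative is recorded by its truncations. -/
lemma HasTorusDeriv.der_mulLp {h h' : C(Torus, ℝ)} (H : HasTorusDeriv h h')
    (S : Finset ℤ) {f g : TorusL2} (hfg : ∀ S', der S' f = proj S' g) :
    der S (mulLp h f) = proj S (mulLp h' f + mulLp h g) := by
  -- With the outer set `S` fixed, `der S` is a bounded operator, so the inner truncation `S'` can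
  -- be sent to the whole of ℤ.
  have t1 : Tendsto (fun S' => der S (mulLp h (proj S' f))) atTop (𝓝 (der S (mulLp h f))) :=
    (((der S).continuous.comp (mulLp h).continuous).tendsto f).comp (tendsto_proj f)
  have t2 : Tendsto (fun S' => proj S (mulLp h' (proj S' f) + mulLp h (proj S' g))) atTop
      (𝓝 (proj S (mulLp h' f + mulLp h g))) :=
    ((proj S).continuous.tendsto _).comp
      ((((mulLp h').continuous.tendsto f).comp (tendsto_proj f)).add
        (((mulLp h).continuous.tendsto g).comp (tendsto_proj g)))
  refine tendsto_nhds_unique t1 (t2.congr fun S' => ?_)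
  rw [H.der_mulLp_proj, hfg]

end Leibniz

/-! ### Simple critical points and the spectral gap inequality. -/

section Shear

lemma torusDeriv_coe {F : Type*} [NormedAddCommGroup F] [NormedSpace ℝ F] (f : Torus → F) (x : ℝ) :
    torusDeriv f (x : Torus) = deriv (fun x : ℝ => f (x : Torus)) x := by
  have h : (fun h : ℝ => f ((x : Torus) + (h : Torus)))
      = fun h : ℝ => (fun x : ℝ => f (x : Torus)) (x + h) := by
    funext h
    simp only [AddCircle.coe_add]
  rw [torusDeriv, h, deriv_comp_const_add (f := fun x : ℝ => f (x : Torus)), add_zero]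

lemma continuous_torus_of_lift {f : Torus → ℝ} (hf : Continuous fun x : ℝ => f (x : Torus)) :
    Continuous f :=
  (QuotientAddGroup.isQuotientMap_mk (N := AddSubgroup.zmultiples (2 * π))).continuous_iff.2 hf

lemma IsSimpleShear.exists_derivatives {v : Torus → ℝ} (hv : IsSimpleShear v) :
    ∃ v₀ v₁ v₂ : C(Torus, ℝ), ⇑v₀ = v ∧ HasTorusDeriv v₀ v₁ ∧ HasTorusDeriv v₁ v₂ ∧
      {y | v₁ y = 0}.Finite ∧ ∀ y, v₁ y = 0 → v₂ y ≠ 0 := by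
  have h2 : ContDiff ℝ 2 (fun x : ℝ => v (x : Torus)) := hv.contDiff
  have e1 : (fun x : ℝ => torusDeriv v (x : Torus)) = deriv (fun x : ℝ => v (x : Torus)) :=
    funext (torusDeriv_coe v)
  have e2 : (fun x : ℝ => torusDeriv (torusDeriv v) (x : Torus))
      = deriv (deriv (fun x : ℝ => v (x : Torus))) := by
    rw [← e1]; exact funext (torusDeriv_coe _)
  have h1 : ContDiff ℝ 1 (deriv (fun x : ℝ => v (x : Torus))) :=
    (contDiff_succ_iff_deriv (n := 1)).1 h2 |>.2.2
  have h0 : Continuous (deriv (deriv (fun x : ℝ => v (x : Torus)))) :=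
    h1.continuous_deriv le_rfl
  refine ⟨⟨v, continuous_torus_of_lift h2.continuous⟩,
    ⟨torusDeriv v, continuous_torus_of_lift (e1 ▸ h1.continuous)⟩,
    ⟨torusDeriv (torusDeriv v), continuous_torus_of_lift (e2 ▸ h0)⟩, rfl, fun x => ?_,
    fun x => ?_, hv.finite_critical, hv.simple_critical⟩
  · simp only [ContinuousMap.coe_mk]
    rw [torusDeriv_coe]
    exact (h2.differentiable (by norm_num) x).hasDerivAt
  · simp only [ContinuousMap.coe_mk]
    rw [torusDeriv_coe, e1]
    exact (h1.differentiable (by norm_num) x).hasDerivAt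

/-- Translation of a continuous function on the torus. -/
noncomputable def torusTranslate (η : ℝ) (h : C(Torus, ℝ)) : C(Torus, ℝ) :=
  h.comp ⟨fun y => y + (η : Torus), by fun_prop⟩

lemma HasTorusDeriv.torusTranslate {h h' : C(Torus, ℝ)} (H : HasTorusDeriv h h') (η : ℝ) :
    HasTorusDeriv (torusTranslate η h) (torusTranslate η h') := fun x => by
  have := (H (x + η)).comp_add_const x η
  simpa [_root_.torusTranslate, AddCircle.coe_add] using this

/-- As v'' is only continuous, it cannot serve as a multiplier in an integration by parts. A
translate of v' is C¹, and v'(y + η) ≈ η v''(y) at a zero y of v', so it has the sign of v''(y) for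
small η > 0. Finiteness of the zero set allows a common η. -/
lemma exists_translate_mul_pos {v₁ v₂ : C(Torus, ℝ)} (H : HasTorusDeriv v₁ v₂)
    (hfin : {y | v₁ y = 0}.Finite) (hs : ∀ y, v₁ y = 0 → v₂ y ≠ 0) :
    ∃ η : ℝ, ∀ y, v₁ y = 0 → 0 < v₂ y * torusTranslate η v₁ y := by
  have key : ∀ y ∈ {y | v₁ y = 0}, ∀ᶠ η : ℝ in 𝓝[>] 0, 0 < v₂ y * torusTranslate η v₁ y := by
    intro y hy
    obtain ⟨x, rfl⟩ := QuotientAddGroup.mk_surjective y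
    have hy' : v₁ (x : Torus) = 0 := hy
    have h2 := hs _ hy'
    have t := ((H x).const_mul (v₂ (x : Torus))).tendsto_slope_zero_right
    have hpos : 0 < v₂ (x : Torus) * v₂ (x : Torus) := mul_self_pos.2 h2
    filter_upwards [t.eventually (lt_mem_nhds hpos), self_mem_nhdsWithin] with η h1 hη
    have hη' : (0 : ℝ) < η := hη
    simp only [hy', mul_zero, sub_zero, smul_eq_mul] at h1
    have h3 := pos_of_mul_pos_right h1 (by positivity)
    simpa [torusTranslate, AddCircle.coe_add] using h3
  obtain ⟨η, hη⟩ := ((hfin.eventually_all).2 key).exists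
  exact ⟨η, fun y hy => hη y hy⟩

/-- Compactness: the open sets {G + nH > 0} increase with n and cover the torus, since H > 0
wherever G fails to be positive. -/
lemma exists_pos_le_add_mul {G H : C(Torus, ℝ)} (hH : ∀ y, 0 ≤ H y)
    (hG : ∀ y, H y = 0 → 0 < G y) : ∃ A δ : ℝ, 0 ≤ A ∧ 0 < δ ∧ ∀ y, δ ≤ G y + A * H y := by
  obtain ⟨n, hn⟩ := isCompact_univ.elim_directed_cover
    (fun n : ℕ => {y : Torus | 0 < G y + n * H y})
    (fun n => isOpen_lt continuous_const (by fun_prop))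
    (fun y _ => by
      rw [mem_iUnion]
      rcases (hH y).eq_or_lt with h | h
      · exact ⟨0, by simpa using hG y h.symm⟩
      · obtain ⟨n, hn⟩ := exists_nat_gt (-G y / H y)
        rw [div_lt_iff₀ h] at hn
        exact ⟨n, by simp only [mem_ofPred_eq]; linarith⟩)
    (Monotone.directed_le fun m n hmn y hy => by
      simp only [mem_ofPred_eq] at hy ⊢
      have : (m : ℝ) ≤ n := by exact_mod_cast hmn
      nlinarith [hH y])
  obtain ⟨y₀, -, hy₀⟩ := isCompact_univ.exists_isMinOn (univ_nonempty (α := Torus))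
    (f := fun y => G y + n * H y) (by fun_prop)
  exact ⟨n, G y₀ + n * H y₀, n.cast_nonneg, hn (mem_univ y₀), fun y => hy₀ (mem_univ y)⟩

/-- Integration by parts gives ⟨u, h'u⟩ = −2 Re⟨∂u, hu⟩. Truncating the product hu is harmless
because it is paired with u = P_S u. -/
lemma HasTorusDeriv.re_inner_mulLp_deriv_le {h h' : C(Torus, ℝ)} (H : HasTorusDeriv h h')
    {S : Finset ℤ} {u : TorusL2} (hu : proj S u = u) :
    (inner ℂ u (mulLp h' u)).re ≤ 2 * ‖mulLp h u‖ * ‖der S u‖ := by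
  have h1 := H.der_mulLp_proj S S u
  rw [hu] at h1
  have h2 : inner ℂ u (der S (mulLp h u)) = inner ℂ u (mulLp h' u) + inner ℂ u (mulLp h (der S u)) := by
    rw [h1, ← inner_proj_left, hu, inner_add_right]
  have h3 : inner ℂ u (der S (mulLp h u)) = -inner ℂ (der S u) (mulLp h u) := by
    rw [inner_der_left, neg_neg]
  have h4 : inner ℂ u (mulLp h' u)
      = -inner ℂ (der S u) (mulLp h u) - inner ℂ (mulLp h u) (der S u) := by
    rw [inner_mulLp_left, ← h3, h2]; ring
  rw [h4, Complex.sub_re, Complex.neg_re]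
  have h5 := (abs_le.1 ((Complex.abs_re_le_norm _).trans
    (norm_inner_le_norm (𝕜 := ℂ) (der S u) (mulLp h u)))).1
  have h6 := (abs_le.1 ((Complex.abs_re_le_norm _).trans
    (norm_inner_le_norm (𝕜 := ℂ) (mulLp h u) (der S u)))).1
  nlinarith

/-- The spectral gap inequality for a profile with simple critical points. -/
lemma exists_interpolation {v₁ v₂ : C(Torus, ℝ)} (H : HasTorusDeriv v₁ v₂)
    (hfin : {y | v₁ y = 0}.Finite) (hs : ∀ y, v₁ y = 0 → v₂ y ≠ 0) :
    ∃ K : ℝ, 1 ≤ K ∧ ∀ (S : Finset ℤ) (u : TorusL2), proj S u = u → ∀ σ : ℝ, 0 < σ → σ ≤ 1 →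
      σ * ‖u‖ ^ 2 ≤ K * (σ ^ 2 * ‖der S u‖ ^ 2 + ‖mulLp v₁ u‖ ^ 2) := by
  obtain ⟨η, hη⟩ := exists_translate_mul_pos H hfin hs
  set τ := torusTranslate η v₁ with hτ
  set τ' := torusTranslate η v₂ with hτ'
  have Hτ : HasTorusDeriv τ τ' := H.torusTranslate η
  -- In (v'τ)' = v''τ + v'τ' the first summand is at least δ − A v'² and the second is O(|v'|). The
  -- bound on ⟨u, (v'τ)'u⟩ then yields δ‖u‖² ≲ ‖v'u‖‖∂u‖ + ‖v'u‖‖u‖ + ‖v'u‖².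
  obtain ⟨A, δ, hA, hδ, hpos⟩ := exists_pos_le_add_mul (G := v₂ * τ) (H := v₁ * v₁)
    (fun y => mul_self_nonneg _) (fun y hy => hη y (mul_self_eq_zero.1 hy))
  set B := ‖τ'‖ ^ 2 / (2 * δ) + A with hB
  have hB0 : 0 ≤ B := by positivity
  refine ⟨max 1 (2 * (‖τ‖ + B) / δ), le_max_left _ _, fun S u hu σ hσ hσ1 => ?_⟩
  have e0 := re_inner_mulLp_nonneg (h := v₂ * τ + A • (v₁ * v₁) + (-δ) • 1)
    (fun y => by
      have := hpos y
      simp only [ContinuousMap.add_apply, ContinuousMap.mul_apply, ContinuousMap.smul_apply,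
        ContinuousMap.one_apply, smul_eq_mul] at this ⊢
      linarith) u
  rw [mulLp_add, mulLp_add, mulLp_smul, mulLp_smul, mulLp_one, inner_add_right, inner_add_right,
    inner_smul_right, inner_smul_right, ← mulLp_mulLp v₁ v₁, ← inner_mulLp_left v₁,
    inner_self_eq_norm_sq_to_K, inner_self_eq_norm_sq_to_K] at e0
  have e1 : (inner ℂ u (mulLp (v₂ * τ) u)).re + A * ‖mulLp v₁ u‖ ^ 2 - δ * ‖u‖ ^ 2 ≥ 0 := by
    have : ((A : ℂ) * ((‖mulLp v₁ u‖ : ℝ) : ℂ) ^ 2).re = A * ‖mulLp v₁ u‖ ^ 2 := by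
      rw [← Complex.ofReal_pow, ← Complex.ofReal_mul, Complex.ofReal_re]
    have h' : (((-δ : ℝ) : ℂ) * ((‖u‖ : ℝ) : ℂ) ^ 2).re = -δ * ‖u‖ ^ 2 := by
      rw [← Complex.ofReal_pow, ← Complex.ofReal_mul, Complex.ofReal_re]
    rw [Complex.add_re, Complex.add_re] at e0
    erw [this, h'] at e0
    linarith
  have e2 := (H.mul Hτ).re_inner_mulLp_deriv_le hu
  rw [mulLp_add, inner_add_right, Complex.add_re, mul_comm v₁ τ, ← mulLp_mulLp τ v₁,
    ← mulLp_mulLp v₁ τ', ← inner_mulLp_left v₁] at e2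
  have e3 : ‖mulLp τ (mulLp v₁ u)‖ ≤ ‖τ‖ * ‖mulLp v₁ u‖ := norm_mulLp_le _ _
  have e4 := (abs_le.1 ((Complex.abs_re_le_norm _).trans
    (norm_inner_le_norm (𝕜 := ℂ) (mulLp v₁ u) (mulLp τ' u)))).1
  have e5 : ‖mulLp τ' u‖ ≤ ‖τ'‖ * ‖u‖ := norm_mulLp_le _ _
  generalize (inner ℂ u (mulLp (v₂ * τ) u)).re = g at *
  generalize (inner ℂ (mulLp v₁ u) (mulLp τ' u)).re = g' at *
  set X := ‖der S u‖
  set Y := ‖mulLp v₁ u‖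
  set U := ‖u‖
  have hX : 0 ≤ X := norm_nonneg _
  have hY : 0 ≤ Y := norm_nonneg _
  have e6 : δ * U ^ 2 ≤ 2 * ‖τ‖ * Y * X + Y * (‖τ'‖ * U) + A * Y ^ 2 := by
    have := mul_le_mul_of_nonneg_right e3 hX
    have := mul_le_mul_of_nonneg_left e5 hY
    nlinarith
  have e7 : Y * (‖τ'‖ * U) ≤ δ / 2 * U ^ 2 + ‖τ'‖ ^ 2 / (2 * δ) * Y ^ 2 := by
    have : δ / 2 * U ^ 2 + ‖τ'‖ ^ 2 / (2 * δ) * Y ^ 2 - Y * (‖τ'‖ * U)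
        = (δ * U - ‖τ'‖ * Y) ^ 2 / (2 * δ) := by field_simp; ring
    have h0 : 0 ≤ (δ * U - ‖τ'‖ * Y) ^ 2 / (2 * δ) := by positivity
    linarith
  have e8 : δ / 2 * U ^ 2 ≤ 2 * ‖τ‖ * Y * X + B * Y ^ 2 := by rw [hB]; linarith
  -- After multiplication by σ, the product (σX)Y splits into squares; σ ≤ 1 serves for the
  -- remaining Y² term.
  have e9 : σ * (δ / 2 * U ^ 2) ≤ (‖τ‖ + B) * (σ ^ 2 * X ^ 2 + Y ^ 2) := by
    have h1 := mul_le_mul_of_nonneg_left e8 hσ.le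
    have h2 : ‖τ‖ * (2 * (σ * X) * Y) ≤ ‖τ‖ * ((σ * X) ^ 2 + Y ^ 2) :=
      mul_le_mul_of_nonneg_left (two_mul_le_add_sq _ _) (norm_nonneg _)
    have h3 : σ * (B * Y ^ 2) ≤ 1 * (B * Y ^ 2) :=
      mul_le_mul_of_nonneg_right hσ1 (by positivity)
    have h4 : 0 ≤ B * (σ ^ 2 * X ^ 2) := by positivity
    nlinarith
  have e10 : σ * U ^ 2 ≤ 2 * (‖τ‖ + B) / δ * (σ ^ 2 * X ^ 2 + Y ^ 2) := by
    rw [div_mul_eq_mul_div, le_div_iff₀ hδ]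
    linarith
  exact e10.trans (mul_le_mul_of_nonneg_right (le_max_right _ _) (by positivity))

end Shear

/-! ### The hypocoercivity functional and the rates of its four terms. -/

section Hypocoercivity

lemma le_add_of_sq_le_four_mul {P p q : ℝ} (hp : 0 ≤ p) (hq : 0 ≤ q) (h : P ^ 2 ≤ 4 * (p * q)) :
    P ≤ p + q := by
  by_contra! hlt
  nlinarith [sq_nonneg (p - q)]

/-- The scalar inequality behind the hypocoercivity estimate. -/
lemma hypocoercive_scalar_bound {ν a b c x m κ L rr U X y Z w : ℝ} (hν : 0 < ν) (ha : 0 < a)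
    (hb : 0 < b) (hc : 0 < c) (hx : 0 ≤ x)
    (hI : L * U ^ 2 ≤ ν * X ^ 2 + b * x * y ^ 2)
    (h1 : 4 * a ^ 2 * x ≤ ν * b) (h2 : 4 * b ^ 2 ≤ a * c) (h3 : 17 * c * ν * m ^ 2 * κ ^ 2 ≤ L)
    (h4 : rr ≤ 2 * L) (h5 : rr * a ≤ ν) (h6 : rr * c ≤ b * x) :
    -(ν * X ^ 2) - a * ν * Z ^ 2 + a * x * (X * y) - b * x * y ^ 2
      + b * ν * (2 * (w * Z) + m * κ * (U * Z)) + c * ν * (2 * (m * κ * (U * w))) - c * ν * w ^ 2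
      ≤ -(1 / 4) * rr * (1 / 2 * U ^ 2 + 3 / 4 * a * X ^ 2 + 3 / 4 * c * y ^ 2) := by
  -- Here U, X, y, Z, w, m stand for ‖u‖, ‖∂u‖, κ‖v'u‖, ‖∂²u‖, κ‖v'∂u‖, ‖v''‖. Young's inequality
  -- spends a quarter of νX² and of bxy², three quarters of the Z² and w² terms, and leaves 17/4 =
  -- 1/4 + 4 copies of cν(mκU)², at most LU²/4 by `h3`. Half of νX² + bxy² supplies LU²/2 through
  -- `hI`, which covers this and the decay of U².
  have s1 : a * x * (X * y) ≤ 1 / 4 * (ν * X ^ 2) + 1 / 4 * (b * x * y ^ 2) := by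
    refine le_add_of_sq_le_four_mul (by positivity) (by positivity) ?_
    have := mul_le_mul_of_nonneg_right h1 (by positivity : 0 ≤ x * (X * y) ^ 2)
    nlinarith
  have s2 : 2 * b * (w * Z) ≤ 1 / 2 * (a * Z ^ 2) + 1 / 2 * (c * w ^ 2) := by
    refine le_add_of_sq_le_four_mul (by positivity) (by positivity) ?_
    have := mul_le_mul_of_nonneg_right h2 (by positivity : 0 ≤ (w * Z) ^ 2)
    nlinarith
  have s3 : b * (m * κ * (U * Z)) ≤ 1 / 4 * (a * Z ^ 2) + 1 / 4 * (c * (m * κ * U) ^ 2) := by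
    refine le_add_of_sq_le_four_mul (by positivity) (by positivity) ?_
    have := mul_le_mul_of_nonneg_right h2 (by positivity : 0 ≤ (m * κ * (U * Z)) ^ 2)
    nlinarith
  have s4 : c * (2 * (m * κ * (U * w))) ≤ 1 / 4 * (c * w ^ 2) + 4 * (c * (m * κ * U) ^ 2) := by
    refine le_add_of_sq_le_four_mul (by positivity) (by positivity) (le_of_eq ?_)
    ring
  have s2' := mul_le_mul_of_nonneg_left s2 hν.le
  have s3' := mul_le_mul_of_nonneg_left s3 hν.le
  have s4' := mul_le_mul_of_nonneg_left s4 hν.le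
  have s5 := mul_le_mul_of_nonneg_right h3 (sq_nonneg U)
  have s6 := mul_le_mul_of_nonneg_right h4 (sq_nonneg U)
  have s7 := mul_le_mul_of_nonneg_right h5 (sq_nonneg X)
  have s8 := mul_le_mul_of_nonneg_right h6 (sq_nonneg y)
  have p1 : 0 ≤ ν * (a * Z ^ 2) := by positivity
  have p2 : 0 ≤ ν * (c * w ^ 2) := by positivity
  have p3 : 0 ≤ ν * X ^ 2 := by positivity
  have p4 : 0 ≤ b * x * y ^ 2 := by positivity
  linarith

/-- The right-hand side of the truncated equation. -/
noncomputable def truncRhs (v₀ : C(Torus, ℝ)) (ν k x : ℝ) (S : Finset ℤ) (g : TorusL2) : TorusL2 :=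
  -(Complex.I * ((k * x : ℝ) : ℂ)) • proj S (mulLp v₀ g) - ((ν * k ^ 2 : ℝ) : ℂ) • proj S g
    + (ν : ℂ) • der S (der S g)

/-- The commutator of the truncation with the transport term. -/
noncomputable def commDefect (v₀ : C(Torus, ℝ)) (S : Finset ℤ) (g : TorusL2) : TorusL2 :=
  mulLp v₀ (proj S g) - proj S (mulLp v₀ g)

/-- The derivative of the commutator. -/
noncomputable def commDefectDeriv (v₀ v₁ : C(Torus, ℝ)) (S : Finset ℤ) (g : TorusL2) : TorusL2 :=
  mulLp v₁ (proj S g) + mulLp v₀ (der S g) - der S (mulLp v₀ g)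

/-- The hypocoercivity functional of the truncation. -/
noncomputable def hypoEnergy (v₁ : C(Torus, ℝ)) (a b c k : ℝ) (S : Finset ℤ) (g : TorusL2) : ℝ :=
  1 / 2 * ‖proj S g‖ ^ 2 + 1 / 2 * a * ‖der S g‖ ^ 2
    + b * k * (inner ℂ (mulLp v₁ (proj S g)) (der S g)).im
    + 1 / 2 * c * k ^ 2 * ‖mulLp v₁ (proj S g)‖ ^ 2

/-- The truncated equation multiplies by v before truncating. This form isolates the transport of
P_S g itself, which carries the algebraic structure, from the commutator error. -/
lemma truncRhs_eq (v₀ : C(Torus, ℝ)) (ν k x : ℝ) (S : Finset ℤ) (g : TorusL2) :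
    truncRhs v₀ ν k x S g =
      -(Complex.I * ((k * x : ℝ) : ℂ)) • mulLp v₀ (proj S g)
        + (Complex.I * ((k * x : ℝ) : ℂ)) • commDefect v₀ S g
        - ((ν * k ^ 2 : ℝ) : ℂ) • proj S g + (ν : ℂ) • der S (der S g) := by
  rw [truncRhs, commDefect]
  module

lemma der_truncRhs_eq (v₀ v₁ : C(Torus, ℝ)) (ν k x : ℝ) (S : Finset ℤ) (g : TorusL2) :
    der S (truncRhs v₀ ν k x S g) =
      -(Complex.I * ((k * x : ℝ) : ℂ)) • (mulLp v₁ (proj S g) + mulLp v₀ (der S g))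
        + (Complex.I * ((k * x : ℝ) : ℂ)) • commDefectDeriv v₀ v₁ S g
        - ((ν * k ^ 2 : ℝ) : ℂ) • der S g + (ν : ℂ) • der S (der S (der S g)) := by
  rw [truncRhs, commDefectDeriv]
  simp only [map_add, map_sub, map_smul, der_proj]
  module

lemma im_inner_mulLp_self (h : C(Torus, ℝ)) (f : TorusL2) : (inner ℂ f (mulLp h f)).im = 0 := by
  have h1 : conj (inner ℂ f (mulLp h f)) = inner ℂ f (mulLp h f) := by
    rw [inner_conj_symm, inner_mulLp_left]
  exact Complex.conj_eq_iff_im.1 h1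

lemma re_inner_self_torus (f : TorusL2) : (inner ℂ f f).re = ‖f‖ ^ 2 :=
  inner_self_eq_norm_sq (𝕜 := ℂ) f

lemma im_inner_self_torus (f : TorusL2) : (inner ℂ f f).im = 0 := inner_self_im (𝕜 := ℂ) f

lemma im_inner_symm_torus (f g : TorusL2) : (inner ℂ f g).im = -(inner ℂ g f).im := by
  rw [← inner_conj_symm, Complex.conj_im]

lemma re_inner_symm_torus (f g : TorusL2) : (inner ℂ f g).re = (inner ℂ g f).re := by
  rw [← inner_conj_symm, Complex.conj_re]

lemma re_inner_der_der (S : Finset ℤ) (f : TorusL2) :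
    (inner ℂ f (der S (der S f))).re = -‖der S f‖ ^ 2 := by
  have := inner_der_left S f (der S f)
  rw [← re_inner_self_torus, this, Complex.neg_re, neg_neg]

/-- Transport drops out, up to the commutator, because ⟨u, vu⟩ is real for real v. -/
lemma energy_rate (v₀ : C(Torus, ℝ)) (ν k x : ℝ) (S : Finset ℤ) (g : TorusL2) :
    (inner ℂ (proj S g) (truncRhs v₀ ν k x S g)).re =
      -ν * ‖der S g‖ ^ 2 - ν * k ^ 2 * ‖proj S g‖ ^ 2
        - k * x * (inner ℂ (proj S g) (commDefect v₀ S g)).im := by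
  rw [truncRhs_eq]
  have h1 := im_inner_mulLp_self v₀ (proj S g)
  have h2 : (inner ℂ (proj S g) (der S (der S g))).re = -‖der S g‖ ^ 2 := by
    rw [inner_proj_left, proj_der, re_inner_der_der]
  simp only [inner_add_right, inner_sub_right, inner_smul_right, neg_mul,
    Complex.add_re, Complex.sub_re, Complex.neg_re, Complex.mul_re, Complex.I_re, Complex.I_im,
    Complex.ofReal_re, Complex.ofReal_im, Complex.mul_im, re_inner_self_torus,
    im_inner_self_torus, h1, h2]
  ring

lemma gradient_rate (v₀ v₁ : C(Torus, ℝ)) (ν k x : ℝ) (S : Finset ℤ) (g : TorusL2) :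
    (inner ℂ (der S g) (der S (truncRhs v₀ ν k x S g))).re =
      k * x * (inner ℂ (der S g) (mulLp v₁ (proj S g))).im
        - k * x * (inner ℂ (der S g) (commDefectDeriv v₀ v₁ S g)).im
        - ν * k ^ 2 * ‖der S g‖ ^ 2 - ν * ‖der S (der S g)‖ ^ 2 := by
  rw [der_truncRhs_eq v₀ v₁]
  have h1 := im_inner_mulLp_self v₀ (der S g)
  have h2 := re_inner_der_der S (der S g)
  simp only [inner_add_right, inner_sub_right, inner_smul_right, neg_mul,
    Complex.add_re, Complex.sub_re, Complex.neg_re, Complex.mul_re, Complex.I_re, Complex.I_im,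
    Complex.ofReal_re, Complex.ofReal_im, Complex.mul_im, Complex.add_im, re_inner_self_torus,
    im_inner_self_torus, h1, h2]
  ring

/-- Source of the extra dissipation: multiplications by v and v' commute, so transport cancels
between the two halves except for [∂, v] = v', which leaves −kξ‖v'u‖². In the viscous part one
derivative is moved off ∂³u, which costs only v''. -/
lemma cross_rate {v₀ v₁ v₂ : C(Torus, ℝ)} (H₁ : HasTorusDeriv v₁ v₂) (ν k x : ℝ)
    (S : Finset ℤ) (g : TorusL2) :
    (inner ℂ (mulLp v₁ (truncRhs v₀ ν k x S g)) (der S g)).im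
      + (inner ℂ (mulLp v₁ (proj S g)) (der S (truncRhs v₀ ν k x S g))).im =
      -(k * x * ‖mulLp v₁ (proj S g)‖ ^ 2)
        - k * x * (inner ℂ (commDefect v₀ S g) (mulLp v₁ (der S g))).re
        + k * x * (inner ℂ (mulLp v₁ (proj S g)) (commDefectDeriv v₀ v₁ S g)).re
        - 2 * (ν * k ^ 2) * (inner ℂ (mulLp v₁ (proj S g)) (der S g)).im
        - ν * (2 * (inner ℂ (mulLp v₁ (der S g)) (der S (der S g))).im
          + (inner ℂ (mulLp v₂ (proj S g)) (der S (der S g))).im) := by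
  rw [inner_mulLp_left, der_truncRhs_eq v₀ v₁, truncRhs_eq]
  have h1 : inner ℂ (mulLp v₀ (proj S g)) (mulLp v₁ (der S g))
      = inner ℂ (mulLp v₁ (proj S g)) (mulLp v₀ (der S g)) := by
    rw [inner_mulLp_left, inner_mulLp_left, mulLp_comm]
  have h2 : inner ℂ (mulLp v₁ (proj S g)) (der S (der S (der S g)))
      = -(inner ℂ (mulLp v₂ (proj S g)) (der S (der S g))
        + inner ℂ (mulLp v₁ (der S g)) (der S (der S g))) := by
    have := inner_der_left S (mulLp v₁ (proj S g)) (der S (der S g))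
    rw [H₁.der_mulLp_proj, inner_proj_left, proj_der, inner_add_left] at this
    rw [this, neg_neg]
  have h3 : inner ℂ (proj S g) (mulLp v₁ (der S g)) = inner ℂ (mulLp v₁ (proj S g)) (der S g) := by
    rw [inner_mulLp_left]
  have h4 := im_inner_symm_torus (der S (der S g)) (mulLp v₁ (der S g))
  simp only [inner_add_left, inner_sub_left, inner_smul_left,
    inner_add_right, inner_sub_right, inner_smul_right, neg_mul, map_neg, map_mul,
    Complex.conj_I, Complex.conj_ofReal, Complex.add_re, Complex.neg_re, Complex.mul_re, Complex.I_re, Complex.I_im,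
    Complex.neg_im, Complex.sub_im, Complex.ofReal_re, Complex.ofReal_im, Complex.mul_im,
    Complex.add_im, re_inner_self_torus, im_inner_self_torus, h1, h2, h3, h4]
  ring

lemma weighted_rate {v₀ v₁ v₂ : C(Torus, ℝ)} (H₁ : HasTorusDeriv v₁ v₂) (ν k x : ℝ)
    (S : Finset ℤ) (g : TorusL2) :
    (inner ℂ (mulLp v₁ (proj S g)) (mulLp v₁ (truncRhs v₀ ν k x S g))).re =
      -(k * x * (inner ℂ (mulLp v₁ (proj S g)) (mulLp v₁ (commDefect v₀ S g))).im)
        - ν * k ^ 2 * ‖mulLp v₁ (proj S g)‖ ^ 2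
        - ν * (2 * (inner ℂ (mulLp v₂ (proj S g)) (mulLp v₁ (der S g))).re
          + ‖mulLp v₁ (der S g)‖ ^ 2) := by
  rw [truncRhs_eq]
  have h1 : (inner ℂ (mulLp v₁ (proj S g)) (mulLp v₁ (mulLp v₀ (proj S g)))).im = 0 := by
    rw [mulLp_comm, im_inner_mulLp_self]
  have h2 : inner ℂ (mulLp v₁ (proj S g)) (mulLp v₁ (der S (der S g)))
      = -(2 * inner ℂ (mulLp v₂ (proj S g)) (mulLp v₁ (der S g))
        + inner ℂ (mulLp v₁ (der S g)) (mulLp v₁ (der S g))) := by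
    have := inner_der_left S (mulLp (v₁ * v₁) (proj S g)) (der S g)
    rw [(H₁.mul H₁).der_mulLp_proj, inner_proj_left, proj_der, inner_add_left, mul_comm v₁ v₂,
      mulLp_add, inner_add_left, mul_comm v₂ v₁, ← mulLp_mulLp, inner_mulLp_left v₁,
      ← mulLp_mulLp v₁ v₁ (der S g), inner_mulLp_left v₁, ← mulLp_mulLp v₁ v₁ (proj S g),
      inner_mulLp_left v₁ (mulLp v₁ (proj S g)) (der S (der S g))] at this
    rw [← neg_eq_iff_eq_neg.2 this]
    ring
  simp only [inner_add_right, inner_sub_right, inner_smul_right, neg_mul,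
    map_add, map_sub, map_smul, Complex.re_ofNat, Complex.im_ofNat,
    Complex.add_re, Complex.sub_re, Complex.neg_re, Complex.mul_re, Complex.I_re, Complex.I_im,
    Complex.ofReal_re, Complex.ofReal_im, Complex.mul_im, re_inner_self_torus,
    im_inner_self_torus, h1, h2]
  ring

lemma abs_im_inner_le (f g : TorusL2) : |(inner ℂ f g).im| ≤ ‖f‖ * ‖g‖ :=
  (Complex.abs_im_le_norm _).trans (norm_inner_le_norm _ _)

lemma abs_re_inner_le (f g : TorusL2) : |(inner ℂ f g).re| ≤ ‖f‖ * ‖g‖ :=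
  (Complex.abs_re_le_norm _).trans (norm_inner_le_norm _ _)

end Hypocoercivity

/-! ### The differential inequality for the functional. -/

section HypocoercivityRate

/-- The formal time derivative of the hypocoercivity functional with time-dependent weights. -/
noncomputable def hypoRate (v₀ v₁ : C(Torus, ℝ)) (a b c a' b' c' ν k x : ℝ) (S : Finset ℤ)
    (g : TorusL2) : ℝ :=
  (inner ℂ (proj S g) (truncRhs v₀ ν k x S g)).re
    + a * (inner ℂ (der S g) (der S (truncRhs v₀ ν k x S g))).re
    + b * k * ((inner ℂ (mulLp v₁ (truncRhs v₀ ν k x S g)) (der S g)).im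
      + (inner ℂ (mulLp v₁ (proj S g)) (der S (truncRhs v₀ ν k x S g))).im)
    + c * k ^ 2 * (inner ℂ (mulLp v₁ (proj S g)) (mulLp v₁ (truncRhs v₀ ν k x S g))).re
    + (1 / 2 * a' * ‖der S g‖ ^ 2 + b' * k * (inner ℂ (mulLp v₁ (proj S g)) (der S g)).im
      + 1 / 2 * c' * k ^ 2 * ‖mulLp v₁ (proj S g)‖ ^ 2)

/-- Under 4b² ≤ ac the cross term is at most half of the two neighbouring squares in Φ, which makes
Φ comparable to its diagonal part. -/
lemma abs_cross_le {a b c k : ℝ} (ha : 0 ≤ a) (hc : 0 ≤ c) (h : 4 * b ^ 2 ≤ a * c)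
    (f g : TorusL2) :
    |b * k * (inner ℂ f g).im| ≤ 1 / 4 * a * ‖g‖ ^ 2 + 1 / 4 * c * k ^ 2 * ‖f‖ ^ 2 := by
  refine le_add_of_sq_le_four_mul (by positivity) (by positivity) ?_
  have h1 := pow_le_pow_left₀ (abs_nonneg _) (abs_im_inner_le f g) 2
  rw [sq_abs] at h1 ⊢
  have h2 := mul_le_mul_of_nonneg_left h1 (by positivity : 0 ≤ b ^ 2 * k ^ 2)
  have h3 := mul_le_mul_of_nonneg_right h (by positivity : 0 ≤ k ^ 2 * (‖f‖ * ‖g‖) ^ 2)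
  nlinarith

lemma half_norm_sq_le_hypoEnergy {v₁ : C(Torus, ℝ)} {a b c k : ℝ} (ha : 0 ≤ a) (hc : 0 ≤ c)
    (h : 4 * b ^ 2 ≤ a * c) (S : Finset ℤ) (g : TorusL2) :
    1 / 2 * ‖proj S g‖ ^ 2 ≤ hypoEnergy v₁ a b c k S g := by
  have h1 := (abs_le.1 (abs_cross_le (k := k) ha hc h (mulLp v₁ (proj S g)) (der S g))).1
  have h2 : 0 ≤ a * ‖der S g‖ ^ 2 := by positivity
  have h3 : 0 ≤ c * k ^ 2 * ‖mulLp v₁ (proj S g)‖ ^ 2 := by positivity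
  rw [hypoEnergy]
  linarith

lemma hypoEnergy_le {v₁ : C(Torus, ℝ)} {a b c k : ℝ} (ha : 0 ≤ a) (hc : 0 ≤ c)
    (h : 4 * b ^ 2 ≤ a * c) (S : Finset ℤ) (g : TorusL2) :
    hypoEnergy v₁ a b c k S g ≤ 1 / 2 * ‖proj S g‖ ^ 2 + 3 / 4 * a * ‖der S g‖ ^ 2
      + 3 / 4 * c * (|k| * ‖mulLp v₁ (proj S g)‖) ^ 2 := by
  have h1 := (abs_le.1 (abs_cross_le (k := k) ha hc h (mulLp v₁ (proj S g)) (der S g))).2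
  rw [hypoEnergy, mul_pow, sq_abs]
  linarith

/-- The size of the commutator errors. -/
noncomputable def defectSize (v₀ v₁ : C(Torus, ℝ)) (S : Finset ℤ) (g : TorusL2) : ℝ :=
  ‖commDefect v₀ S g‖ + ‖commDefectDeriv v₀ v₁ S g‖

lemma energy_rate_le (v₀ v₁ : C(Torus, ℝ)) {ν k x : ℝ} (hx : 0 ≤ x) (S : Finset ℤ) (g : TorusL2) :
    (inner ℂ (proj S g) (truncRhs v₀ ν k x S g)).re ≤
      -ν * ‖der S g‖ ^ 2 - ν * k ^ 2 * ‖proj S g‖ ^ 2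
        + |k| * x * ((‖proj S g‖ + ‖der S g‖) * defectSize v₀ v₁ S g) := by
  rw [energy_rate, defectSize]
  have h1 : |k * x * (inner ℂ (proj S g) (commDefect v₀ S g)).im| ≤
      |k| * x * (‖proj S g‖ * ‖commDefect v₀ S g‖) := by
    rw [abs_mul, abs_mul, abs_of_nonneg hx]
    exact mul_le_mul_of_nonneg_left (abs_im_inner_le _ _) (by positivity)
  have h2 := (abs_le.1 h1).1
  have h3 : ‖proj S g‖ * ‖commDefect v₀ S g‖ ≤ (‖proj S g‖ + ‖der S g‖) *
      (‖commDefect v₀ S g‖ + ‖commDefectDeriv v₀ v₁ S g‖) := by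
    gcongr <;> linarith [norm_nonneg (der S g), norm_nonneg (commDefectDeriv v₀ v₁ S g)]
  have h4 := mul_le_mul_of_nonneg_left h3 (by positivity : 0 ≤ |k| * x)
  linarith

/-- The differential inequality for the hypocoercivity functional. -/
lemma hypoRate_le {v₀ v₁ v₂ : C(Torus, ℝ)} (H₁ : HasTorusDeriv v₁ v₂)
    {a b c a' b' c' ν k x L rr : ℝ} {S : Finset ℤ} {g : TorusL2}
    (hν : 0 < ν) (ha : 0 < a) (hb : 0 < b) (hc : 0 < c) (hx : 0 ≤ x) (hrr : 0 ≤ rr)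
    (hI : L * ‖proj S g‖ ^ 2 ≤
      ν * ‖der S g‖ ^ 2 + b * x * (|k| * ‖mulLp v₁ (proj S g)‖) ^ 2)
    (h1 : 4 * a ^ 2 * x ≤ ν * b) (h2 : 4 * b ^ 2 ≤ a * c)
    (h3 : 17 * c * ν * ‖v₂‖ ^ 2 * |k| ^ 2 ≤ L)
    (h4 : rr ≤ 2 * L) (h5 : rr * a ≤ ν) (h6 : rr * c ≤ b * x)
    (ha' : a' ≤ 0) (hc' : c' ≤ 0) (hb' : b' ^ 2 ≤ a' * c') :
    hypoRate v₀ v₁ a b c a' b' c' ν k x S g ≤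
      -(2 * ν * k ^ 2 + 1 / 4 * rr) * hypoEnergy v₁ a b c k S g
        + |k| * x * ((1 + a + |k| * b * ‖v₁‖ + c * k ^ 2 * ‖v₁‖ ^ 2) *
          ((‖proj S g‖ + ‖der S g‖) * defectSize v₀ v₁ S g)) := by
  have e1 := energy_rate v₀ ν k x S g
  have e2 := gradient_rate v₀ v₁ ν k x S g
  have e3 := cross_rate (v₀ := v₀) H₁ ν k x S g
  have e4 := weighted_rate (v₀ := v₀) H₁ ν k x S g
  rw [hypoRate, e1, e2, e3, e4]
  have hle := hypoEnergy_le (v₁ := v₁) (k := k) ha.le hc.le h2 S g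
  have hΦ : hypoEnergy v₁ a b c k S g = 1 / 2 * ‖proj S g‖ ^ 2 + 1 / 2 * a * ‖der S g‖ ^ 2
    + b * k * (inner ℂ (mulLp v₁ (proj S g)) (der S g)).im
    + 1 / 2 * c * k ^ 2 * ‖mulLp v₁ (proj S g)‖ ^ 2 := rfl
  have core := hypocoercive_scalar_bound (Z := ‖der S (der S g)‖)
    (w := |k| * ‖mulLp v₁ (der S g)‖) hν ha hb hc hx hI h1 h2 h3 h4 h5 h6
  have hΦ4 := mul_le_mul_of_nonneg_left hle (by positivity : 0 ≤ 1 / 4 * rr)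
  clear e1 e2 e3 e4 hI h1 h3 h4 h5 h6
  -- The weight derivatives form a negative semidefinite quadratic form: `abs_cross_le` with −2a'
  -- and −2c' bounds its cross term by exactly the size of its two squares.
  have hcoef : 1 / 2 * a' * ‖der S g‖ ^ 2
      + b' * k * (inner ℂ (mulLp v₁ (proj S g)) (der S g)).im
      + 1 / 2 * c' * k ^ 2 * ‖mulLp v₁ (proj S g)‖ ^ 2 ≤ 0 := by
    have := (abs_le.1 (abs_cross_le (k := k) (a := -(2 * a')) (b := b') (c := -(2 * c'))
      (by linarith) (by linarith) (by nlinarith) (mulLp v₁ (proj S g)) (der S g))).2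
    linarith
  have hM : ∀ f : TorusL2, ‖mulLp v₁ f‖ ≤ ‖v₁‖ * ‖f‖ := norm_mulLp_le v₁
  have hk : k ^ 2 = |k| ^ 2 := (sq_abs k).symm
  -- the main terms
  have t1 : a * (k * x * (inner ℂ (der S g) (mulLp v₁ (proj S g))).im) ≤
      a * x * (‖der S g‖ * (|k| * ‖mulLp v₁ (proj S g)‖)) := by
    have : k * (inner ℂ (der S g) (mulLp v₁ (proj S g))).im ≤
        |k| * (‖der S g‖ * ‖mulLp v₁ (proj S g)‖) := by
      refine (le_abs_self _).trans ?_
      rw [abs_mul]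
      exact mul_le_mul_of_nonneg_left (abs_im_inner_le _ _) (abs_nonneg _)
    have := mul_le_mul_of_nonneg_left this (by positivity : 0 ≤ a * x)
    linarith
  have t2 : b * k * (-ν * (2 * (inner ℂ (mulLp v₁ (der S g)) (der S (der S g))).im
      + (inner ℂ (mulLp v₂ (proj S g)) (der S (der S g))).im)) ≤
      b * ν * (2 * (|k| * ‖mulLp v₁ (der S g)‖ * ‖der S (der S g)‖)
        + ‖v₂‖ * |k| * (‖proj S g‖ * ‖der S (der S g)‖)) := by
    have i1 := abs_im_inner_le (mulLp v₁ (der S g)) (der S (der S g))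
    have i2 := (abs_im_inner_le (mulLp v₂ (proj S g)) (der S (der S g))).trans
      (mul_le_mul_of_nonneg_right (norm_mulLp_le v₂ (proj S g)) (norm_nonneg _))
    have i3 : |k * (-(2 * (inner ℂ (mulLp v₁ (der S g)) (der S (der S g))).im
      + (inner ℂ (mulLp v₂ (proj S g)) (der S (der S g))).im))| ≤
        |k| * (2 * (‖mulLp v₁ (der S g)‖ * ‖der S (der S g)‖)
          + ‖v₂‖ * ‖proj S g‖ * ‖der S (der S g)‖) := by
      rw [abs_mul, abs_neg]
      refine mul_le_mul_of_nonneg_left ((abs_add_le _ _).trans ?_) (abs_nonneg _)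
      rw [abs_mul, abs_two]
      linarith
    have := mul_le_mul_of_nonneg_left ((le_abs_self _).trans i3) (by positivity : 0 ≤ b * ν)
    linarith
  have t3 : c * k ^ 2 * (-ν * (2 * (inner ℂ (mulLp v₂ (proj S g)) (mulLp v₁ (der S g))).re)) ≤
      c * ν * (2 * (‖v₂‖ * |k| * (‖proj S g‖ * (|k| * ‖mulLp v₁ (der S g)‖)))) := by
    have i1 := (abs_re_inner_le (mulLp v₂ (proj S g)) (mulLp v₁ (der S g))).trans
      (mul_le_mul_of_nonneg_right (norm_mulLp_le v₂ (proj S g)) (norm_nonneg _))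
    have := mul_le_mul_of_nonneg_left (abs_le.1 i1).1 (by positivity : 0 ≤ c * k ^ 2 * ν)
    rw [hk] at this ⊢
    linarith
  -- the commutator terms
  have r1 : -(k * x * (inner ℂ (proj S g) (commDefect v₀ S g)).im) ≤
      |k| * x * (‖proj S g‖ * ‖commDefect v₀ S g‖) := by
    refine (neg_le_abs _).trans ?_
    rw [abs_mul, abs_mul, abs_of_nonneg hx]
    exact mul_le_mul_of_nonneg_left (abs_im_inner_le _ _) (by positivity)
  have r2 : a * -(k * x * (inner ℂ (der S g) (commDefectDeriv v₀ v₁ S g)).im) ≤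
      |k| * x * (a * (‖der S g‖ * ‖commDefectDeriv v₀ v₁ S g‖)) := by
    have : -(k * x * (inner ℂ (der S g) (commDefectDeriv v₀ v₁ S g)).im) ≤
        |k| * x * (‖der S g‖ * ‖commDefectDeriv v₀ v₁ S g‖) := by
      refine (neg_le_abs _).trans ?_
      rw [abs_mul, abs_mul, abs_of_nonneg hx]
      exact mul_le_mul_of_nonneg_left (abs_im_inner_le _ _) (by positivity)
    have := mul_le_mul_of_nonneg_left this ha.le
    linarith
  have r3 : b * k * (-(k * x * (inner ℂ (commDefect v₀ S g) (mulLp v₁ (der S g))).re)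
      + k * x * (inner ℂ (mulLp v₁ (proj S g)) (commDefectDeriv v₀ v₁ S g)).re) ≤
      |k| * x * (|k| * b * ‖v₁‖ * (‖commDefect v₀ S g‖ * ‖der S g‖
        + ‖proj S g‖ * ‖commDefectDeriv v₀ v₁ S g‖)) := by
    have i1 := (abs_re_inner_le (commDefect v₀ S g) (mulLp v₁ (der S g))).trans
      (mul_le_mul_of_nonneg_left (hM (der S g)) (norm_nonneg _))
    have i2 := (abs_re_inner_le (mulLp v₁ (proj S g)) (commDefectDeriv v₀ v₁ S g)).trans
      (mul_le_mul_of_nonneg_right (hM (proj S g)) (norm_nonneg _))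
    have := mul_le_mul_of_nonneg_left (add_le_add (neg_le_of_abs_le i1) (le_of_abs_le i2))
      (by positivity : 0 ≤ |k| * |k| * x * b)
    have hk' : |k| * |k| = k * k := abs_mul_abs_self k
    have e : b * k * (-(k * x * (inner ℂ (commDefect v₀ S g) (mulLp v₁ (der S g))).re)
      + k * x * (inner ℂ (mulLp v₁ (proj S g)) (commDefectDeriv v₀ v₁ S g)).re)
      = k * k * x * b * (-(inner ℂ (commDefect v₀ S g) (mulLp v₁ (der S g))).re
        + (inner ℂ (mulLp v₁ (proj S g)) (commDefectDeriv v₀ v₁ S g)).re) := by ring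
    rw [e, ← hk']
    linarith
  have r4 : c * k ^ 2 * -(k * x * (inner ℂ (mulLp v₁ (proj S g))
      (mulLp v₁ (commDefect v₀ S g))).im) ≤
      |k| * x * (c * k ^ 2 * ‖v₁‖ ^ 2 * (‖proj S g‖ * ‖commDefect v₀ S g‖)) := by
    have i1 : -(k * x * (inner ℂ (mulLp v₁ (proj S g)) (mulLp v₁ (commDefect v₀ S g))).im) ≤
        |k| * x * ((‖v₁‖ * ‖proj S g‖) * (‖v₁‖ * ‖commDefect v₀ S g‖)) := by
      refine (neg_le_abs _).trans ?_
      rw [abs_mul, abs_mul, abs_of_nonneg hx]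
      refine mul_le_mul_of_nonneg_left ((abs_im_inner_le _ _).trans ?_) (by positivity)
      exact mul_le_mul (hM _) (hM _) (norm_nonneg _) (by positivity)
    have := mul_le_mul_of_nonneg_left i1 (by positivity : 0 ≤ c * k ^ 2)
    linarith
  have hcomm : ‖proj S g‖ * ‖commDefect v₀ S g‖ + a * (‖der S g‖ * ‖commDefectDeriv v₀ v₁ S g‖)
      + |k| * b * ‖v₁‖ * (‖commDefect v₀ S g‖ * ‖der S g‖
        + ‖proj S g‖ * ‖commDefectDeriv v₀ v₁ S g‖)
      + c * k ^ 2 * ‖v₁‖ ^ 2 * (‖proj S g‖ * ‖commDefect v₀ S g‖) ≤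
      (1 + a + |k| * b * ‖v₁‖ + c * k ^ 2 * ‖v₁‖ ^ 2) *
          ((‖proj S g‖ + ‖der S g‖) * defectSize v₀ v₁ S g) := by
    rw [defectSize]
    have hU := norm_nonneg (proj S g)
    have hX := norm_nonneg (der S g)
    have hρ := norm_nonneg (commDefect v₀ S g)
    have hρ' := norm_nonneg (commDefectDeriv v₀ v₁ S g)
    generalize ‖proj S g‖ = U at *
    generalize ‖der S g‖ = X at *
    generalize ‖commDefect v₀ S g‖ = ρ at *
    generalize ‖commDefectDeriv v₀ v₁ S g‖ = ρ' at *
    have p1 := mul_nonneg hU hρ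
    have p2 := mul_nonneg hU hρ'
    have p3 := mul_nonneg hX hρ
    have p4 := mul_nonneg hX hρ'
    have q1 : U * ρ ≤ (U + X) * (ρ + ρ') := by linarith
    have q2 : X * ρ' ≤ (U + X) * (ρ + ρ') := by linarith
    have q3 : ρ * X + U * ρ' ≤ (U + X) * (ρ + ρ') := by linarith
    have q2' := mul_le_mul_of_nonneg_left q2 ha.le
    have q3' := mul_le_mul_of_nonneg_left q3 (by positivity : 0 ≤ |k| * b * ‖v₁‖)
    have q4' := mul_le_mul_of_nonneg_left q1 (by positivity : 0 ≤ c * k ^ 2 * ‖v₁‖ ^ 2)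
    linarith
  have hcomm' := mul_le_mul_of_nonneg_left hcomm (by positivity : 0 ≤ |k| * x)
  have hy : b * x * (|k| * ‖mulLp v₁ (proj S g)‖) ^ 2 = b * k * (k * x * ‖mulLp v₁ (proj S g)‖ ^ 2)
      := by rw [mul_pow, ← hk]; ring
  have hw : c * ν * (|k| * ‖mulLp v₁ (der S g)‖) ^ 2 = c * k ^ 2 * (ν * ‖mulLp v₁ (der S g)‖ ^ 2)
      := by rw [mul_pow, ← hk]; ring
  -- The −νk² contributions to the four rates add up to exactly −2νk²Φ.
  have hΦ' := congrArg (fun z => 2 * ν * k ^ 2 * z) hΦ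
  linarith

end HypocoercivityRate

/-! ### The choice of weights and the inequalities they satisfy. -/

section Weights

/-- The weight of the gradient term, as a function of `q = 1 + ν ^ s * t`. -/
noncomputable def gradWeight (K ν κ β ℓ q : ℝ) : ℝ :=
  K / 2 * (√ν * √β / √κ) * q ^ (-(1 + ℓ / 2))

/-- The weight of the cross term, as a function of `q = 1 + ν ^ s * t`. -/
noncomputable def crossWeight (K κ β q : ℝ) : ℝ := K ^ 2 * (β / κ) * q ^ (-2 : ℝ)

/-- The weight of the transport term, as a function of `q = 1 + ν ^ s * t`. -/
noncomputable def shearWeight (K ν κ β ℓ q : ℝ) : ℝ :=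
  8 * K ^ 3 * (√β ^ 3 / (√κ ^ 3 * √ν)) * q ^ (-(3 - ℓ / 2))

/-- The instantaneous decay rate, as a function of `q = 1 + ν ^ s * t`. -/
noncomputable def decayRate (ν κ β x q : ℝ) : ℝ := √(β * ν * κ) * (√x * q⁻¹)

/-- The admissible range of the parameters at one time, with `q = 1 + ν ^ s * t`. -/
structure Admissible (C ν κ β ℓ x q : ℝ) : Prop where
  ν_pos : 0 < ν
  ν_le : ν ≤ 1
  κ_ge : 1 ≤ κ
  β_ge : ν / κ ≤ β
  β_le : C * β ≤ 1
  ℓ_mem : ℓ ∈ Icc (2 : ℝ) 4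
  q_ge : 1 ≤ q
  x_ge : (C * β) ^ 2 ≤ x
  x_ge' : ν / (κ * β) * q ^ 2 ≤ x
  x_le : x ≤ q ^ ℓ

variable {C K m ν κ β ℓ x q : ℝ}

lemma Admissible.β_pos (h : Admissible C ν κ β ℓ x q) : 0 < β :=
  (div_pos h.ν_pos (by linarith [h.κ_ge])).trans_le h.β_ge

lemma Admissible.q_pos (h : Admissible C ν κ β ℓ x q) : 0 < q := by linarith [h.q_ge]

lemma Admissible.κ_pos (h : Admissible C ν κ β ℓ x q) : 0 < κ := by linarith [h.κ_ge]

lemma Admissible.x_pos (h : Admissible C ν κ β ℓ x q) : 0 < x := by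
  have := h.ν_pos; have := h.κ_pos; have := h.β_pos; have := h.q_pos
  exact lt_of_lt_of_le (by positivity) h.x_ge'

lemma gradWeight_eq (hq : 0 < q) :
    gradWeight K ν κ β ℓ q = K / 2 * (√ν * √β / √κ) * (q ^ 2 * q ^ (ℓ / 2 - 1))⁻¹ := by
  rw [gradWeight, ← Real.rpow_natCast q 2, ← Real.rpow_add hq, ← Real.rpow_neg hq.le]
  congr 2
  push_cast
  ring

lemma crossWeight_eq (hq : 0 < q) : crossWeight K κ β q = K ^ 2 * (β / κ) * (q ^ 2)⁻¹ := by
  rw [crossWeight, Real.rpow_neg hq.le, Real.rpow_two]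

lemma shearWeight_eq (hq : 0 < q) :
    shearWeight K ν κ β ℓ q =
      8 * K ^ 3 * (√β ^ 3 / (√κ ^ 3 * √ν)) * (q ^ (ℓ / 2 - 1) * (q ^ 2)⁻¹) := by
  rw [shearWeight, ← Real.rpow_natCast q 2, ← Real.rpow_neg hq.le, ← Real.rpow_add hq]
  congr 2
  push_cast
  ring

/-- The inequalities satisfied by the square roots of the parameters. -/
lemma Admissible.sqrt_bounds (h : Admissible C ν κ β ℓ x q) :
    (1 ≤ q ^ (ℓ / 2 - 1) ∧ q ^ (ℓ / 2 - 1) ≤ q) ∧ √x ≤ q * q ^ (ℓ / 2 - 1) ∧ C * √β ^ 2 ≤ √x ∧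
      √ν * q ≤ √x * (√κ * √β) ∧ C * √β ^ 2 ≤ 1 := by
  have hν := h.ν_pos; have hκ := h.κ_pos; have hβ := h.β_pos; have hq := h.q_pos
  have hℓ := h.ℓ_mem
  refine ⟨⟨Real.one_le_rpow h.q_ge (by linarith [hℓ.1]), ?_⟩, ?_, ?_, ?_, ?_⟩
  · calc q ^ (ℓ / 2 - 1) ≤ q ^ (1 : ℝ) :=
        Real.rpow_le_rpow_of_exponent_le h.q_ge (by linarith [hℓ.2])
      _ = q := Real.rpow_one q
  · rw [Real.sqrt_le_left (by positivity)]
    refine h.x_le.trans (le_of_eq ?_)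
    rw [mul_pow, ← Real.rpow_natCast q 2, ← Real.rpow_natCast (q ^ (ℓ / 2 - 1)) 2,
      ← Real.rpow_mul hq.le, ← Real.rpow_add hq]
    congr 1
    push_cast
    ring
  · rw [Real.sq_sqrt hβ.le]
    exact Real.le_sqrt_of_sq_le h.x_ge
  · rw [← Real.sqrt_mul hκ.le, ← Real.sqrt_mul h.x_pos.le]
    refine Real.le_sqrt_of_sq_le ?_
    rw [mul_pow, Real.sq_sqrt hν.le]
    have := h.x_ge'
    rw [div_mul_eq_mul_div, div_le_iff₀ (by positivity)] at this
    exact this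
  · rw [Real.sq_sqrt hβ.le]
    exact h.β_le

lemma decayRate_eq (h : Admissible C ν κ β ℓ x q) :
    decayRate ν κ β x q = √ν * √β * √κ * √x / q := by
  rw [decayRate, Real.sqrt_mul (by have := h.β_pos; have := h.ν_pos; positivity),
    Real.sqrt_mul h.β_pos.le, div_eq_mul_inv]
  ring

lemma decayRate_nonneg (hq : 0 ≤ q) : 0 ≤ decayRate ν κ β x q := by
  rw [decayRate]; positivity

/-- The algebraic conditions on the weights. -/
lemma Admissible.weight_conditions (h : Admissible C ν κ β ℓ x q) (hK : 1 ≤ K)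
    (hC1 : 8 * K ≤ C) (hC2 : 136 * K ^ 3 * m ^ 2 ≤ C) :
    4 * gradWeight K ν κ β ℓ q ^ 2 * x ≤ ν * crossWeight K κ β q ∧
    4 * crossWeight K κ β q ^ 2 = gradWeight K ν κ β ℓ q * shearWeight K ν κ β ℓ q ∧
    17 * shearWeight K ν κ β ℓ q * ν * m ^ 2 * κ ^ 2 ≤ decayRate ν κ β x q ∧
    decayRate ν κ β x q * gradWeight K ν κ β ℓ q ≤ ν ∧
    decayRate ν κ β x q * shearWeight K ν κ β ℓ q ≤ crossWeight K κ β q * x := by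
  have hqp := h.q_pos
  obtain ⟨⟨hQ1, hQq⟩, hxU, hxC, -, hβ1⟩ := h.sqrt_bounds
  rw [gradWeight_eq hqp, crossWeight_eq hqp, shearWeight_eq hqp, decayRate_eq h]
  have hν2 : ν = √ν ^ 2 := (Real.sq_sqrt h.ν_pos.le).symm
  have hκ2 : κ = √κ ^ 2 := (Real.sq_sqrt h.κ_pos.le).symm
  have hβ2 : β = √β ^ 2 := (Real.sq_sqrt h.β_pos.le).symm
  have hx2 : x = √x ^ 2 := (Real.sq_sqrt h.x_pos.le).symm
  have hn : 0 < √ν := Real.sqrt_pos.2 h.ν_pos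
  have hp : 0 < √κ := Real.sqrt_pos.2 h.κ_pos
  have hB : 0 < √β := Real.sqrt_pos.2 h.β_pos
  have hX : 0 < √x := Real.sqrt_pos.2 h.x_pos
  have hq1 := h.q_ge
  clear h
  generalize q ^ (ℓ / 2 - 1) = Q at *
  generalize √ν = n at *
  generalize √κ = p at *
  generalize √β = B at *
  generalize √x = X at *
  subst hν2 hκ2 hβ2 hx2
  have hQ : 0 < Q := by linarith
  have hK0 : 0 < K := by linarith
  have hC : 0 < C := by linarith
  -- The upper bound on ξ, as √ξ ≤ qQ, gives the first condition and, with Cβ ≤ 1, the fourth. The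
  -- lower bound Cβ ≤ √ξ gives the third and fifth. The second is an identity, which determines c
  -- from a and b.
  refine ⟨?_, ?_, ?_, ?_, ?_⟩
  · have e1 : 4 * (K / 2 * (n * B / p) * (q ^ 2 * Q)⁻¹) ^ 2 * X ^ 2
        = (K ^ 2 * n ^ 2 * B ^ 2 / p ^ 2 / q ^ 2) * (X / (q * Q)) ^ 2 := by field_simp; ring
    have e2 : n ^ 2 * (K ^ 2 * (B ^ 2 / p ^ 2) * (q ^ 2)⁻¹)
        = (K ^ 2 * n ^ 2 * B ^ 2 / p ^ 2 / q ^ 2) * 1 := by field_simp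
    rw [e1, e2]
    have : X / (q * Q) ≤ 1 := (div_le_one (by positivity)).2 hxU
    exact mul_le_mul_of_nonneg_left (pow_le_one₀ (by positivity) this) (by positivity)
  · field_simp
    ring
  · have e1 : 17 * (8 * K ^ 3 * (B ^ 3 / (p ^ 3 * n)) * (Q * (q ^ 2)⁻¹)) * n ^ 2 * m ^ 2
        * (p ^ 2) ^ 2 = (n * B * p / q) * ((136 * K ^ 3 * m ^ 2) * B ^ 2 * (Q / q)) := by
      field_simp; ring
    have e2 : n * B * p * X / q = (n * B * p / q) * X := by ring
    rw [e1, e2]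
    refine mul_le_mul_of_nonneg_left ?_ (by positivity)
    have : Q / q ≤ 1 := (div_le_one hqp).2 hQq
    calc (136 * K ^ 3 * m ^ 2) * B ^ 2 * (Q / q) ≤ C * B ^ 2 * 1 := by gcongr
      _ ≤ X := by linarith
  · have e1 : n * B * p * X / q * (K / 2 * (n * B / p) * (q ^ 2 * Q)⁻¹)
        = n ^ 2 * ((K / 2 * B ^ 2) * (X / (q * Q)) * (q ^ 2)⁻¹) := by field_simp
    rw [e1]
    have h1 : X / (q * Q) ≤ 1 := (div_le_one (by positivity)).2 hxU
    have h2 : (q ^ 2)⁻¹ ≤ 1 := inv_le_one_of_one_le₀ (one_le_pow₀ hq1)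
    have h3 : K / 2 * B ^ 2 ≤ 1 := le_trans (by gcongr; linarith) hβ1
    have h4 : (K / 2 * B ^ 2) * (X / (q * Q)) * (q ^ 2)⁻¹ ≤ 1 * 1 * 1 := by gcongr
    calc n ^ 2 * ((K / 2 * B ^ 2) * (X / (q * Q)) * (q ^ 2)⁻¹) ≤ n ^ 2 * (1 * 1 * 1) := by gcongr
      _ = n ^ 2 := by ring
  · have e1 : n * B * p * X / q * (8 * K ^ 3 * (B ^ 3 / (p ^ 3 * n)) * (Q * (q ^ 2)⁻¹))
        = (K ^ 2 * B ^ 2 / p ^ 2 * X / q ^ 2) * ((8 * K) * B ^ 2 * (Q / q)) := by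
      field_simp
    have e2 : K ^ 2 * (B ^ 2 / p ^ 2) * (q ^ 2)⁻¹ * X ^ 2
        = (K ^ 2 * B ^ 2 / p ^ 2 * X / q ^ 2) * X := by field_simp
    rw [e1, e2]
    refine mul_le_mul_of_nonneg_left ?_ (by positivity)
    have : Q / q ≤ 1 := (div_le_one hqp).2 hQq
    calc 8 * K * B ^ 2 * (Q / q) ≤ C * B ^ 2 * 1 := by gcongr
      _ ≤ X := by linarith

/-- The coercivity supplied by the interpolation inequality. -/
lemma Admissible.coercivity (h : Admissible C ν κ β ℓ x q) (hK : 1 ≤ K)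
    {U X Y : ℝ}
    (hint : ∀ σ : ℝ, 0 < σ → σ ≤ 1 → σ * U ^ 2 ≤ K * (σ ^ 2 * X ^ 2 + Y ^ 2)) :
    decayRate ν κ β x q * U ^ 2 ≤ ν * X ^ 2 + crossWeight K κ β q * x * (κ * Y) ^ 2 := by
  have hqp := h.q_pos
  obtain ⟨-, -, -, hσ, -⟩ := h.sqrt_bounds
  rw [crossWeight_eq hqp, decayRate_eq h]
  have hν2 : ν = √ν ^ 2 := (Real.sq_sqrt h.ν_pos.le).symm
  have hκ2 : κ = √κ ^ 2 := (Real.sq_sqrt h.κ_pos.le).symm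
  have hβ2 : β = √β ^ 2 := (Real.sq_sqrt h.β_pos.le).symm
  have hx2 : x = √x ^ 2 := (Real.sq_sqrt h.x_pos.le).symm
  have hn : 0 < √ν := Real.sqrt_pos.2 h.ν_pos
  have hp : 0 < √κ := Real.sqrt_pos.2 h.κ_pos
  have hB : 0 < √β := Real.sqrt_pos.2 h.β_pos
  have hX : 0 < √x := Real.sqrt_pos.2 h.x_pos
  clear h
  generalize √ν = n at *
  generalize √κ = p at *
  generalize √β = B at *
  generalize √x = z at *
  subst hν2 hκ2 hβ2 hx2
  have hK0 : 0 < K := by linarith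
  -- The scale σ = √ν q/(K√(ξκβ)) makes the coefficient of X² exactly ν after rescaling. That σ ≤ 1
  -- is the lower bound ξ ≥ νq²/(κβ).
  have h1 := hint (n * q / (K * (z * (p * B)))) (by positivity) (by
    rw [div_le_one (by positivity)]
    have : 1 * (z * (p * B)) ≤ K * (z * (p * B)) := by gcongr
    linarith)
  have h2 := mul_le_mul_of_nonneg_left h1 (by positivity : 0 ≤ K * (B * p * z / q) ^ 2)
  have e1 : K * (B * p * z / q) ^ 2 * (n * q / (K * (z * (p * B))) * U ^ 2)
      = n * B * p * z / q * U ^ 2 := by field_simp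
  have e2 : K * (B * p * z / q) ^ 2 * (K * ((n * q / (K * (z * (p * B)))) ^ 2 * X ^ 2 + Y ^ 2))
      = n ^ 2 * X ^ 2 + K ^ 2 * (B ^ 2 / p ^ 2) * (q ^ 2)⁻¹ * z ^ 2 * (p ^ 2 * Y) ^ 2 := by
    field_simp
  rw [← e1, ← e2]
  exact h2

/-- This bounds the cost of the term c k²‖v'u‖² in terms of ‖u‖² and is the origin of the factor
(|k|/ν)^{1/2} in the theorem. -/
lemma Admissible.shearWeight_mul_le (h : Admissible C ν κ β ℓ x q) (hC : 1 ≤ C) (hK : 1 ≤ K) :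
    shearWeight K ν κ β ℓ q * κ ^ 2 ≤ 8 * K ^ 3 * √(κ / ν) := by
  have hqp := h.q_pos
  obtain ⟨⟨hQ1, hQq⟩, -, -, -, hβ1⟩ := h.sqrt_bounds
  rw [shearWeight_eq hqp, Real.sqrt_div h.κ_pos.le]
  have hκ2 : κ = √κ ^ 2 := (Real.sq_sqrt h.κ_pos.le).symm
  have hn : 0 < √ν := Real.sqrt_pos.2 h.ν_pos
  have hp : 0 < √κ := Real.sqrt_pos.2 h.κ_pos
  have hB : 0 < √β := Real.sqrt_pos.2 h.β_pos
  have hq1 := h.q_ge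
  clear h
  generalize q ^ (ℓ / 2 - 1) = Q at *
  generalize √ν = n at *
  generalize √κ = p at *
  generalize √β = B at *
  subst hκ2
  have hK0 : 0 < K := by linarith
  have e1 : 8 * K ^ 3 * (B ^ 3 / (p ^ 3 * n)) * (Q * (q ^ 2)⁻¹) * (p ^ 2) ^ 2
      = (8 * K ^ 3 * (p / n)) * (B ^ 3 * (Q / q) * q⁻¹) := by field_simp
  rw [e1]
  have hB1 : B ≤ 1 := by
    by_contra! hlt
    nlinarith
  have h1 : Q / q ≤ 1 := (div_le_one hqp).2 hQq
  have h2 : q⁻¹ ≤ 1 := inv_le_one_of_one_le₀ hq1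
  have h3 : B ^ 3 ≤ 1 := pow_le_one₀ hB.le hB1
  have h4 : 0 ≤ Q / q := by positivity
  calc (8 * K ^ 3 * (p / n)) * (B ^ 3 * (Q / q) * q⁻¹)
      ≤ (8 * K ^ 3 * (p / n)) * (1 * 1 * 1) := by gcongr
    _ = 8 * K ^ 3 * (p / n) := by ring

end Weights

/-! ### Absolute continuity and an integrated Grönwall inequality. -/

section Gronwall

lemma LipschitzOnWith.bounded_Icc {E : Type*} [NormedAddCommGroup E] {f : ℝ → E} {K : NNReal}
    {a b : ℝ} (hf : LipschitzOnWith K f (Icc a b)) : ∃ B : ℝ, ∀ t ∈ Icc a b, ‖f t‖ ≤ B :=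
  isCompact_Icc.exists_bound_of_continuousOn hf.continuousOn

lemma exists_lipschitzOnWith_inner {E : Type*} [NormedAddCommGroup E] [InnerProductSpace ℂ E]
    {f g : ℝ → E} {K K' : NNReal} {a b : ℝ} (hf : LipschitzOnWith K f (Icc a b))
    (hg : LipschitzOnWith K' g (Icc a b)) :
    ∃ L : NNReal, LipschitzOnWith L (fun t => inner ℂ (f t) (g t)) (Icc a b) := by
  obtain ⟨B, hB⟩ := hf.bounded_Icc
  obtain ⟨B', hB'⟩ := hg.bounded_Icc
  refine ⟨(K * |B'| + |B| * K').toNNReal, LipschitzOnWith.of_dist_le_mul fun s hs t ht => ?_⟩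
  rw [Real.coe_toNNReal _ (by positivity), dist_eq_norm]
  have e : inner ℂ (f s) (g s) - inner ℂ (f t) (g t)
      = inner ℂ (f s - f t) (g s) + inner ℂ (f t) (g s - g t) := by
    rw [inner_sub_left, inner_sub_right]; ring
  have h1 := hf.dist_le_mul s hs t ht
  have h2 := hg.dist_le_mul s hs t ht
  rw [dist_eq_norm] at h1 h2
  rw [e]
  calc ‖inner ℂ (f s - f t) (g s) + inner ℂ (f t) (g s - g t)‖
      ≤ ‖f s - f t‖ * ‖g s‖ + ‖f t‖ * ‖g s - g t‖ :=
        (norm_add_le _ _).trans (add_le_add (norm_inner_le_norm _ _) (norm_inner_le_norm _ _))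
    _ ≤ (K * dist s t) * |B'| + |B| * (K' * dist s t) := by
        gcongr
        · exact (hB' s hs).trans (le_abs_self _)
        · exact (hB t ht).trans (le_abs_self _)
    _ = (K * |B'| + |B| * K') * dist s t := by ring

lemma absolutelyContinuous_re_inner {E : Type*} [NormedAddCommGroup E] [InnerProductSpace ℂ E]
    {f g : ℝ → E} {K K' : NNReal} {a b : ℝ} (hab : a ≤ b) (hf : LipschitzOnWith K f (Icc a b))
    (hg : LipschitzOnWith K' g (Icc a b)) :
    AbsolutelyContinuousOnInterval (fun t => (inner ℂ (f t) (g t)).re) a b := by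
  obtain ⟨L, hL⟩ := exists_lipschitzOnWith_inner hf hg
  refine LipschitzOnWith.absolutelyContinuousOnInterval (K := L) ?_
  rw [uIcc_of_le hab]
  refine LipschitzOnWith.of_dist_le_mul fun s hs t ht => ?_
  refine le_trans ?_ (hL.dist_le_mul s hs t ht)
  rw [dist_eq_norm, dist_eq_norm, ← Complex.sub_re]
  exact Complex.abs_re_le_norm _

lemma absolutelyContinuous_im_inner {E : Type*} [NormedAddCommGroup E] [InnerProductSpace ℂ E]
    {f g : ℝ → E} {K K' : NNReal} {a b : ℝ} (hab : a ≤ b) (hf : LipschitzOnWith K f (Icc a b))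
    (hg : LipschitzOnWith K' g (Icc a b)) :
    AbsolutelyContinuousOnInterval (fun t => (inner ℂ (f t) (g t)).im) a b := by
  obtain ⟨L, hL⟩ := exists_lipschitzOnWith_inner hf hg
  refine LipschitzOnWith.absolutelyContinuousOnInterval (K := L) ?_
  rw [uIcc_of_le hab]
  refine LipschitzOnWith.of_dist_le_mul fun s hs t ht => ?_
  refine le_trans ?_ (hL.dist_le_mul s hs t ht)
  rw [dist_eq_norm, dist_eq_norm, ← Complex.sub_im]
  exact Complex.abs_im_le_norm _

lemma absolutelyContinuous_exp_comp {ρ : ℝ → ℝ} {K : NNReal} {a b : ℝ} (hab : a ≤ b)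
    (hρ : LipschitzOnWith K ρ (Icc a b)) :
    AbsolutelyContinuousOnInterval (fun t => Real.exp (ρ t)) a b := by
  obtain ⟨B, hB⟩ := hρ.bounded_Icc
  obtain ⟨L, hL⟩ := (Real.contDiff_exp (n := 1)).contDiffOn.exists_lipschitzOnWith
    (s := Icc (-B) B) (by decide) (convex_Icc _ _) isCompact_Icc
  refine LipschitzOnWith.absolutelyContinuousOnInterval (K := L * K) ?_
  rw [uIcc_of_le hab]
  exact hL.comp hρ fun t ht => abs_le.1 (hB t ht)

/-- An integrated Grönwall inequality with dissipation and forcing. -/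
lemma gronwall_integrated {Φ ρ d e : ℝ → ℝ} {K : NNReal} {T M : ℝ} (hT : 0 ≤ T)
    (hΦ : AbsolutelyContinuousOnInterval Φ 0 T) (hρ : LipschitzOnWith K ρ (Icc 0 T))
    (hM : ∀ t ∈ Icc 0 T, ρ t ≤ M) (hd : ContinuousOn d (Icc 0 T))
    (he : IntervalIntegrable e volume 0 T) (he0 : ∀ t, 0 ≤ e t)
    (hder : ∀ᵐ t, t ∈ Ioo 0 T → ∃ Φ' ρ', HasDerivAt Φ Φ' t ∧ HasDerivAt ρ ρ' t ∧
      Φ' ≤ -(ρ' * Φ t) - d t + e t) {s t : ℝ} (hs : 0 ≤ s) (hst : s ≤ t) (ht : t ≤ T) :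
    Φ t * Real.exp (ρ t) + ∫ τ in s..t, d τ * Real.exp (ρ τ) ≤
      Φ s * Real.exp (ρ s) + Real.exp M * ∫ τ in (0 : ℝ)..T, e τ := by
  have hE := absolutelyContinuous_exp_comp hT hρ
  have hsub : uIcc s t ⊆ uIcc 0 T := by
    rw [uIcc_of_le hst, uIcc_of_le hT]; exact Icc_subset_Icc hs ht
  have hF := (hΦ.fun_mul hE).mono hsub
  have hftc := hF.integral_deriv_eq_sub
  have hcexp : ContinuousOn (fun τ => Real.exp (ρ τ)) (uIcc s t) :=
    (Real.continuous_exp.comp_continuousOn hρ.continuousOn).mono (by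
      rw [uIcc_of_le hst]; exact Icc_subset_Icc hs ht)
  have hcd : ContinuousOn d (uIcc s t) := hd.mono (by
      rw [uIcc_of_le hst]; exact Icc_subset_Icc hs ht)
  have ie : IntervalIntegrable e volume s t := he.mono_set hsub
  have i1 : IntervalIntegrable (fun τ => Real.exp M * e τ) volume s t := ie.const_mul _
  have i2 : IntervalIntegrable (fun τ => d τ * Real.exp (ρ τ)) volume s t :=
    (hcd.mul hcexp).intervalIntegrable
  have hmono := intervalIntegral.integral_mono_ae_restrict hst hF.intervalIntegrable_deriv (i1.sub i2) ?_
  · rw [hftc, intervalIntegral.integral_sub i1 i2, intervalIntegral.integral_const_mul] at hmono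
    have h3 : ∫ τ in s..t, e τ ≤ ∫ τ in (0 : ℝ)..T, e τ :=
      intervalIntegral.integral_mono_interval hs hst ht (Eventually.of_forall he0) he
    have h4 := mul_le_mul_of_nonneg_left h3 (Real.exp_pos M).le
    linarith
  · rw [EventuallyLE, ae_restrict_iff' measurableSet_Icc]
    have n0 : ∀ᵐ τ : ℝ, τ ≠ 0 := by simp [ae_iff, measure_singleton]
    have nT : ∀ᵐ τ : ℝ, τ ≠ T := by simp [ae_iff, measure_singleton]
    filter_upwards [hder, n0, nT] with τ h1 h2 h3 h4
    have h0 : 0 ≤ τ := hs.trans h4.1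
    have hT' : τ ≤ T := h4.2.trans ht
    obtain ⟨Φ', ρ', hΦ', hρ', hle⟩ := h1 ⟨lt_of_le_of_ne h0 (Ne.symm h2), lt_of_le_of_ne hT' h3⟩
    rw [(hΦ'.fun_mul hρ'.exp).deriv]
    have h5 := mul_le_mul_of_nonneg_right hle (Real.exp_pos (ρ τ)).le
    -- Replacing the exponential weight by its maximum is lossy but harmless: in the applications
    -- the integral of `e` vanishes as the truncation is removed.
    have h6 : e τ * Real.exp (ρ τ) ≤ e τ * Real.exp M :=
      mul_le_mul_of_nonneg_left (Real.exp_le_exp.2 (hM τ ⟨h0, hT'⟩)) (he0 τ)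
    linarith

end Gronwall

/-! ### The evolution equation of a truncated weak solution. -/

section TruncatedEquation

lemma torusContDiff_fourier (n : ℤ) : TorusContDiff ∞ (fun y : Torus => (fourier n y : ℂ)) := by
  rw [TorusContDiff]
  simp_rw [fourier_coe_apply]
  have : ContDiff ℝ ∞ fun x : ℝ => (x : ℂ) := Complex.ofRealCLM.contDiff
  exact ((contDiff_const.mul this).div_const _).cexp

lemma torusDeriv_fourier (n : ℤ) (y : Torus) :
    torusDeriv (fun y : Torus => (fourier n y : ℂ)) y = Complex.I * n * fourier n y := by
  obtain ⟨x, rfl⟩ := QuotientAddGroup.mk_surjective y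
  exact (torusDeriv_coe _ x).trans (hasDerivAt_fourier_torus n x).deriv

lemma modeCoeff_eq_integral (n : ℤ) (f : TorusL2) :
    modeCoeff n f = ((Real.sqrt (2 * π))⁻¹ : ℂ) * ∫ y : Torus, f y * fourier (-n) y :=
  inner_torusMode n f

lemma IsWeakDeriv.modeCoeff_eq {f g : TorusL2} (h : IsWeakDeriv f g) (n : ℤ) :
    modeCoeff n g = Complex.I * n * modeCoeff n f := by
  have h1 := h _ (torusContDiff_fourier (-n))
  simp only [torusDeriv_fourier] at h1
  have e : ∫ y : Torus, f y * (Complex.I * ((-n : ℤ) : ℂ) * fourier (-n) y)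
      = -(Complex.I * n) * ∫ y : Torus, f y * fourier (-n) y := by
    rw [← integral_const_mul]
    congr 1
    funext y
    push_cast
    ring
  rw [modeCoeff_eq_integral, modeCoeff_eq_integral, ← neg_eq_iff_eq_neg.2 h1, e]
  ring

lemma IsWeakDeriv.der_eq {f g : TorusL2} (h : IsWeakDeriv f g) (S : Finset ℤ) :
    der S f = proj S g :=
  der_eq_proj fun n _ => (h.modeCoeff_eq n).symm

lemma modeCoeff_truncRhs (v₀ : C(Torus, ℝ)) (ν k x : ℝ) {S : Finset ℤ} {n : ℤ} (hn : n ∈ S)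
    (g : TorusL2) :
    modeCoeff n (truncRhs v₀ ν k x S g) =
      -(Complex.I * k * x * modeCoeff n (mulLp v₀ g)) - ν * k ^ 2 * modeCoeff n g
        + ν * (Complex.I * n * (Complex.I * n * modeCoeff n g)) := by
  simp only [truncRhs, map_add, map_sub, map_smul, smul_eq_mul, modeCoeff_proj, modeCoeff_der,
    if_pos hn]
  push_cast
  ring

lemma proj_truncRhs (v₀ : C(Torus, ℝ)) (ν k x : ℝ) (S : Finset ℤ) (g : TorusL2) :
    proj S (truncRhs v₀ ν k x S g) = truncRhs v₀ ν k x S g := by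
  simp only [truncRhs, map_add, map_sub, map_smul, proj_proj, proj_der]

variable {ν T Ξ : ℝ} {k : ℤ} {ξ : ℝ → ℝ} {v : Torus → ℝ} {v₀ : C(Torus, ℝ)} {Θ₀ : TorusL2}
  {Θ : ℝ → TorusL2}

lemma exists_bound_truncRhs (hΘ : ContinuousOn Θ (Icc 0 T))
    (hξ : ∀ t ∈ Icc 0 T, 0 ≤ ξ t ∧ ξ t ≤ Ξ) (S : Finset ℤ) :
    ∃ B : ℝ, 0 ≤ B ∧ ∀ t ∈ Icc 0 T, ‖truncRhs v₀ ν k (ξ t) S (Θ t)‖ ≤ B := by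
  obtain ⟨B₁, hB₁⟩ := isCompact_Icc.exists_bound_of_continuousOn
    ((((proj S).comp (mulLp v₀)).continuous).comp_continuousOn hΘ)
  obtain ⟨B₂, hB₂⟩ := isCompact_Icc.exists_bound_of_continuousOn
    ((proj S).continuous.comp_continuousOn hΘ)
  obtain ⟨B₃, hB₃⟩ := isCompact_Icc.exists_bound_of_continuousOn
    ((((der S).comp (der S)).continuous).comp_continuousOn hΘ)
  refine ⟨|(k : ℝ)| * |Ξ| * |B₁| + |ν * (k : ℝ) ^ 2| * |B₂| + |ν| * |B₃|, by positivity,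
    fun t ht => ?_⟩
  rw [truncRhs]
  refine (norm_add_le _ _).trans (add_le_add ((norm_sub_le _ _).trans (add_le_add ?_ ?_)) ?_)
  · rw [norm_smul, norm_neg, norm_mul, Complex.norm_I, one_mul, Complex.norm_real, Real.norm_eq_abs,
      abs_mul]
    gcongr
    · exact (hξ t ht).1
    · exact (hξ t ht).2
    · exact (hB₁ t ht).trans (le_abs_self _)
  · rw [norm_smul, Complex.norm_real, Real.norm_eq_abs]
    gcongr
    exact (hB₂ t ht).trans (le_abs_self _)
  · rw [norm_smul, Complex.norm_real, Real.norm_eq_abs]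
    gcongr
    exact (hB₃ t ht).trans (le_abs_self _)

lemma intervalIntegrable_truncRhs (hT : 0 ≤ T) (hΘ : ContinuousOn Θ (Icc 0 T))
    (hξm : AEStronglyMeasurable ξ (volume.restrict (Icc 0 T)))
    (hξ : ∀ t ∈ Icc 0 T, 0 ≤ ξ t ∧ ξ t ≤ Ξ) (S : Finset ℤ) :
    IntervalIntegrable (fun t => truncRhs v₀ ν k (ξ t) S (Θ t)) volume 0 T := by
  obtain ⟨B, -, hB⟩ := exists_bound_truncRhs (v₀ := v₀) (ν := ν) (k := k) hΘ hξ S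
  rw [intervalIntegrable_iff_integrableOn_Icc_of_le hT]
  have hm : AEStronglyMeasurable Θ (volume.restrict (Icc 0 T)) :=
    hΘ.aestronglyMeasurable measurableSet_Icc
  refine Integrable.of_bound (μ := volume.restrict (Icc 0 T)) ?_ B ?_
  · have h1 : Continuous fun x : ℝ => -(Complex.I * (((k : ℝ) * x : ℝ) : ℂ)) := by fun_prop
    have m1 : AEStronglyMeasurable (fun t => -(Complex.I * (((k : ℝ) * ξ t : ℝ) : ℂ)))
        (volume.restrict (Icc 0 T)) := h1.comp_aestronglyMeasurable hξm
    have m2 : AEStronglyMeasurable (fun t => proj S (mulLp v₀ (Θ t)))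
        (volume.restrict (Icc 0 T)) :=
      ((proj S).continuous.comp (mulLp v₀).continuous).comp_aestronglyMeasurable hm
    have m3 : AEStronglyMeasurable (fun t => proj S (Θ t)) (volume.restrict (Icc 0 T)) :=
      (proj S).continuous.comp_aestronglyMeasurable hm
    have m4 : AEStronglyMeasurable (fun t => der S (der S (Θ t))) (volume.restrict (Icc 0 T)) :=
      ((der S).continuous.comp (der S).continuous).comp_aestronglyMeasurable hm
    exact ((m1.smul m2).sub (m3.const_smul ((ν * (k : ℝ) ^ 2 : ℝ) : ℂ))).add
      (m4.const_smul (ν : ℂ))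
  · rw [ae_restrict_iff' measurableSet_Icc]
    exact Eventually.of_forall hB

/-- The truncated equation in integrated form. -/
lemma IsWeakSolution.proj_eq (hsol : IsWeakSolution ν k T ξ v Θ₀ Θ) (hv : ⇑v₀ = v)
    (hT : 0 ≤ T) (hξm : AEStronglyMeasurable ξ (volume.restrict (Icc 0 T)))
    (hξ : ∀ t ∈ Icc 0 T, 0 ≤ ξ t ∧ ξ t ≤ Ξ) (S : Finset ℤ) {t : ℝ} (ht : t ∈ Icc 0 T) :
    proj S (Θ t) = proj S Θ₀ + ∫ τ in (0 : ℝ)..t, truncRhs v₀ ν k (ξ τ) S (Θ τ) := by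
  have hint := (intervalIntegrable_truncRhs (v₀ := v₀) (ν := ν) (k := k) hT hsol.continuousOn hξm
    hξ S).mono_set (c := 0) (d := t) (by
      rw [uIcc_of_le ht.1, uIcc_of_le hT]; exact Icc_subset_Icc le_rfl ht.2)
  -- The integral lies in the range of P_S, so only the modes n ∈ S need comparing; there the weak
  -- formulation is tested against e^{−iny}.
  have e1 : ∫ τ in (0 : ℝ)..t, truncRhs v₀ ν k (ξ τ) S (Θ τ)
      = proj S (∫ τ in (0 : ℝ)..t, truncRhs v₀ ν k (ξ τ) S (Θ τ)) := by
    rw [← (proj S).intervalIntegral_comp_comm hint]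
    simp only [proj_truncRhs]
  rw [e1, ← map_add]
  refine proj_congr fun n hn => ?_
  rw [map_add, ← (modeCoeff n).intervalIntegral_comp_comm hint]
  obtain ⟨D, -, hD, heq⟩ := hsol.equation
  have key := heq _ (torusContDiff_fourier (-n)) t ht
  simp only [torusDeriv_fourier] at key
  rw [modeCoeff_eq_integral, key, mul_add, modeCoeff_eq_integral,
    ← intervalIntegral.integral_const_mul]
  congr 1
  apply intervalIntegral.integral_congr_ae
  rw [ae_restrict_iff' measurableSet_Icc] at hD
  filter_upwards [hD] with τ h1 h2
  rw [uIoc_of_le ht.1] at h2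
  have hw := (h1 ⟨h2.1.le, h2.2.trans ht.2⟩).modeCoeff_eq n
  rw [modeCoeff_truncRhs _ _ _ _ hn, ← hw]
  have e2 : modeCoeff n (mulLp v₀ (Θ τ))
      = ((Real.sqrt (2 * π))⁻¹ : ℂ) * ∫ y : Torus, (v y : ℂ) * Θ τ y * fourier (-n) y := by
    rw [modeCoeff_eq_integral]
    congr 1
    apply integral_congr_ae
    filter_upwards [coeFn_mulLp v₀ (Θ τ)] with y hy
    rw [hy, hv]
  have e3 : ∫ y : Torus, D τ y * (Complex.I * ((-n : ℤ) : ℂ) * fourier (-n) y)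
      = -(Complex.I * n) * ∫ y : Torus, D τ y * fourier (-n) y := by
    rw [← integral_const_mul]
    congr 1
    funext y
    push_cast
    ring
  rw [e2, e3, modeCoeff_eq_integral n (D τ), modeCoeff_eq_integral n (Θ τ)]
  push_cast
  ring

lemma IsWeakSolution.exists_lipschitzOnWith_proj (hsol : IsWeakSolution ν k T ξ v Θ₀ Θ)
    (hv : ⇑v₀ = v) (hT : 0 ≤ T) (hξm : AEStronglyMeasurable ξ (volume.restrict (Icc 0 T)))
    (hξ : ∀ t ∈ Icc 0 T, 0 ≤ ξ t ∧ ξ t ≤ Ξ) (S : Finset ℤ) :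
    ∃ K : NNReal, LipschitzOnWith K (fun t => proj S (Θ t)) (Icc 0 T) := by
  obtain ⟨B, hB0, hB⟩ := exists_bound_truncRhs (v₀ := v₀) (ν := ν) (k := k) hsol.continuousOn hξ S
  have hint := intervalIntegrable_truncRhs (v₀ := v₀) (ν := ν) (k := k) hT hsol.continuousOn hξm
    hξ S
  refine ⟨B.toNNReal, LipschitzOnWith.of_dist_le_mul fun s hs t ht => ?_⟩
  have hsub : ∀ r ∈ Icc 0 T, uIcc 0 r ⊆ uIcc 0 T := fun r hr => by
    rw [uIcc_of_le hr.1, uIcc_of_le hT]; exact Icc_subset_Icc le_rfl hr.2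
  rw [Real.coe_toNNReal _ hB0, dist_eq_norm, Real.dist_eq,
    hsol.proj_eq hv hT hξm hξ S hs, hsol.proj_eq hv hT hξm hξ S ht, add_sub_add_left_eq_sub,
    intervalIntegral.integral_interval_sub_left (hint.mono_set (hsub s hs))
      (hint.mono_set (hsub t ht))]
  refine intervalIntegral.norm_integral_le_of_norm_le_const fun τ hτ => hB τ ?_
  have := uIoc_subset_uIcc hτ
  exact (uIcc_subset_Icc ht hs) this

/-- Since ξ is merely measurable, Lebesgue differentiation gives the derivative only almost
everywhere; the Lipschitz bound supplies the absolute continuity needed to integrate it. -/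
lemma IsWeakSolution.ae_hasDerivAt_proj (hsol : IsWeakSolution ν k T ξ v Θ₀ Θ)
    (hv : ⇑v₀ = v) (hT : 0 ≤ T) (hξm : AEStronglyMeasurable ξ (volume.restrict (Icc 0 T)))
    (hξ : ∀ t ∈ Icc 0 T, 0 ≤ ξ t ∧ ξ t ≤ Ξ) (S : Finset ℤ) :
    ∀ᵐ t, t ∈ Ioo 0 T →
      HasDerivAt (fun t => proj S (Θ t)) (truncRhs v₀ ν k (ξ t) S (Θ t)) t := by
  have hint := intervalIntegrable_truncRhs (v₀ := v₀) (ν := ν) (k := k) hT hsol.continuousOn hξm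
    hξ S
  filter_upwards [hint.ae_hasDerivAt_integral] with t h1 ht
  have h2 := h1 (by rw [uIcc_of_le hT]; exact Ioo_subset_Icc_self ht) 0 left_mem_uIcc
  refine (h2.const_add (proj S Θ₀)).congr_of_eventuallyEq ?_
  filter_upwards [Ioo_mem_nhds ht.1 ht.2] with r hr
  exact hsol.proj_eq hv hT hξm hξ S (Ioo_subset_Icc_self hr)

end TruncatedEquation

/-! ### Energy and hypocoercivity estimates for the truncations. -/

section TruncatedEstimates

lemma hasDerivAt_re_inner {f g : ℝ → TorusL2} {f' g' : TorusL2} {t : ℝ}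
    (hf : HasDerivAt f f' t) (hg : HasDerivAt g g' t) :
    HasDerivAt (fun t => (inner ℂ (f t) (g t)).re)
      ((inner ℂ (f t) g').re + (inner ℂ f' (g t)).re) t := by
  have := Complex.reCLM.hasFDerivAt.comp_hasDerivAt t (hf.inner ℂ hg)
  simpa [Function.comp_def] using this

lemma hasDerivAt_im_inner {f g : ℝ → TorusL2} {f' g' : TorusL2} {t : ℝ}
    (hf : HasDerivAt f f' t) (hg : HasDerivAt g g' t) :
    HasDerivAt (fun t => (inner ℂ (f t) (g t)).im)
      ((inner ℂ (f t) g').im + (inner ℂ f' (g t)).im) t := by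
  have := Complex.imCLM.hasFDerivAt.comp_hasDerivAt t (hf.inner ℂ hg)
  simpa [Function.comp_def] using this

lemma HasDerivAt.clm_torus {f : ℝ → TorusL2} {f' : TorusL2} {t : ℝ}
    (A : TorusL2 →L[ℂ] TorusL2) (hf : HasDerivAt f f' t) :
    HasDerivAt (fun t => A (f t)) (A f') t :=
  (A.restrictScalars ℝ).hasFDerivAt.comp_hasDerivAt t hf

lemma LipschitzOnWith.clm_torus {f : ℝ → TorusL2} {K : NNReal} {s : Set ℝ}
    (A : TorusL2 →L[ℂ] TorusL2) (hf : LipschitzOnWith K f s) :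
    LipschitzOnWith (‖A‖₊ * K) (fun t => A (f t)) s :=
  A.lipschitz.comp_lipschitzOnWith hf

/-- The forcing produced by the commutator errors. -/
noncomputable def forcing (v₀ v₁ : C(Torus, ℝ)) (S : Finset ℤ) (g : TorusL2) : ℝ :=
  (‖proj S g‖ + ‖der S g‖) * defectSize v₀ v₁ S g

lemma forcing_nonneg (v₀ v₁ : C(Torus, ℝ)) (S : Finset ℤ) (g : TorusL2) :
    0 ≤ forcing v₀ v₁ S g := by
  rw [forcing, defectSize]; positivity

lemma continuous_forcing (v₀ v₁ : C(Torus, ℝ)) (S : Finset ℤ) :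
    Continuous (forcing v₀ v₁ S) := by
  unfold forcing defectSize commDefect commDefectDeriv
  fun_prop

variable {ν T Ξ : ℝ} {k : ℝ} {ξ : ℝ → ℝ} {v₀ v₁ v₂ : C(Torus, ℝ)} {Θ : ℝ → TorusL2}
  {S : Finset ℤ} {Ku : NNReal}

/-- The dissipation integral is kept because it later pays for a‖∂u‖² in the average over the
initial layer. -/
lemma truncated_energy_estimate (hT : 0 ≤ T) (hΘ : ContinuousOn Θ (Icc 0 T))
    (hν : 0 ≤ ν) (hξ : ∀ t ∈ Icc 0 T, 0 ≤ ξ t ∧ ξ t ≤ Ξ)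
    (hLip : LipschitzOnWith Ku (fun t => proj S (Θ t)) (Icc 0 T))
    (hder : ∀ᵐ t, t ∈ Ioo 0 T →
      HasDerivAt (fun t => proj S (Θ t)) (truncRhs v₀ ν k (ξ t) S (Θ t)) t)
    {t : ℝ} (ht : t ∈ Icc 0 T) :
    1 / 2 * ‖proj S (Θ t)‖ ^ 2 * Real.exp (2 * ν * k ^ 2 * t)
      + ∫ τ in (0 : ℝ)..t, ν * ‖der S (Θ τ)‖ ^ 2 * Real.exp (2 * ν * k ^ 2 * τ) ≤
      1 / 2 * ‖proj S (Θ 0)‖ ^ 2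
        + Real.exp (2 * ν * k ^ 2 * T) *
          ∫ τ in (0 : ℝ)..T, |k| * |Ξ| * forcing v₀ v₁ S (Θ τ) := by
  have hρc : ContDiff ℝ 1 fun t : ℝ => 2 * ν * k ^ 2 * t := by fun_prop
  obtain ⟨Kρ, hKρ⟩ := hρc.contDiffOn.exists_lipschitzOnWith (s := Icc 0 T) (by decide)
    (convex_Icc _ _) isCompact_Icc
  have hac : AbsolutelyContinuousOnInterval (fun t => 1 / 2 * ‖proj S (Θ t)‖ ^ 2) 0 T := by
    simp only [← re_inner_self_torus]
    exact (absolutelyContinuous_re_inner hT hLip hLip).const_mul _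
  have hcd : ContinuousOn (fun τ => ν * ‖der S (Θ τ)‖ ^ 2) (Icc 0 T) :=
    (((der S).continuous.comp_continuousOn hΘ).norm.pow 2).const_smul ν
  have hce : ContinuousOn (fun τ => |k| * |Ξ| * forcing v₀ v₁ S (Θ τ)) (uIcc 0 T) := by
    rw [uIcc_of_le hT]
    exact ((continuous_forcing v₀ v₁ S).comp_continuousOn hΘ).const_smul (|k| * |Ξ|)
  have := gronwall_integrated (M := 2 * ν * k ^ 2 * T) hT hac hKρ
    (fun t ht => mul_le_mul_of_nonneg_left ht.2 (by positivity)) hcd hce.intervalIntegrable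
    (fun τ => mul_nonneg (by positivity) (forcing_nonneg _ _ _ _)) ?_ le_rfl ht.1 ht.2
  · simpa using this
  · filter_upwards [hder] with τ h1 h2
    have h3 := h1 h2
    have hx := hξ τ (Ioo_subset_Icc_self h2)
    refine ⟨1 / 2 * (2 * (inner ℂ (proj S (Θ τ)) (truncRhs v₀ ν k (ξ τ) S (Θ τ))).re),
      2 * ν * k ^ 2, ?_, ?_, ?_⟩
    · have h4 := (hasDerivAt_re_inner h3 h3).const_mul (1 / 2 : ℝ)
      simp only [← re_inner_self_torus]
      convert! h4 using 2
      rw [re_inner_symm_torus (truncRhs v₀ ν k (ξ τ) S (Θ τ))]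
      ring
    · simpa using (hasDerivAt_id τ).const_mul (2 * ν * k ^ 2)
    · have h5 := energy_rate_le v₀ v₁ (ν := ν) (k := k) hx.1 S (Θ τ)
      have h6 : |k| * ξ τ * forcing v₀ v₁ S (Θ τ) ≤ |k| * |Ξ| * forcing v₀ v₁ S (Θ τ) := by
        have := forcing_nonneg v₀ v₁ S (Θ τ)
        have := hx.2.trans (le_abs_self Ξ)
        gcongr
      rw [← forcing] at h5
      linarith

lemma hasDerivAt_affine_rpow {ρ t : ℝ} (A p : ℝ) (hq : 0 < 1 + ρ * t) :
    HasDerivAt (fun t => A * (1 + ρ * t) ^ p) (p * (ρ / (1 + ρ * t)) * (A * (1 + ρ * t) ^ p)) t := by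
  have h1 : HasDerivAt (fun t => 1 + ρ * t) ρ t := by
    simpa using ((hasDerivAt_id t).const_mul ρ).const_add 1
  have h2 := (h1.rpow_const (p := p) (Or.inl hq.ne')).const_mul A
  convert! h2 using 1
  rw [Real.rpow_sub_one hq.ne']
  field_simp

lemma absolutelyContinuous_affine_rpow {ρ : ℝ} (hρ : 0 ≤ ρ) (hT : 0 ≤ T) (A p : ℝ) :
    AbsolutelyContinuousOnInterval (fun t => A * (1 + ρ * t) ^ p) 0 T := by
  refine ContDiffOn.absolutelyContinuousOnInterval ?_
  rw [uIcc_of_le hT]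
  refine contDiffOn_const.mul (ContDiffOn.rpow_const_of_ne (by fun_prop) fun t ht => ?_)
  have := mul_nonneg hρ ht.1
  positivity

/-- The total of the weights that multiply the commutator errors. -/
noncomputable def weightTotal (v₁ : C(Torus, ℝ)) (K ν κ β : ℝ) : ℝ :=
  1 + K / 2 * (√ν * √β / √κ) + κ * (K ^ 2 * (β / κ)) * ‖v₁‖
    + 8 * K ^ 3 * (√β ^ 3 / (√κ ^ 3 * √ν)) * κ ^ 2 * ‖v₁‖ ^ 2

variable {C K β ℓ ρ : ℝ}

/-- The starting time s is left free, since Φ at time zero is not controlled by the L² norm of the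
data uniformly in `S`. -/
lemma truncated_hypo_estimate (H₁ : HasTorusDeriv v₁ v₂) (hT : 0 ≤ T)
    (hΘ : ContinuousOn Θ (Icc 0 T)) (hρ : 0 ≤ ρ)
    (hK : 1 ≤ K) (hC1 : 8 * K ≤ C) (hC2 : 136 * K ^ 3 * ‖v₂‖ ^ 2 ≤ C)
    (hint : ∀ (S : Finset ℤ) (u : TorusL2), proj S u = u → ∀ σ : ℝ, 0 < σ → σ ≤ 1 →
      σ * ‖u‖ ^ 2 ≤ K * (σ ^ 2 * ‖der S u‖ ^ 2 + ‖mulLp v₁ u‖ ^ 2))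
    (hadm : ∀ t ∈ Icc 0 T, Admissible C ν |k| β ℓ (ξ t) (1 + ρ * t))
    (hξ : ∀ t ∈ Icc 0 T, 0 ≤ ξ t ∧ ξ t ≤ Ξ)
    (hLip : LipschitzOnWith Ku (fun t => proj S (Θ t)) (Icc 0 T))
    (hder : ∀ᵐ t, t ∈ Ioo 0 T →
      HasDerivAt (fun t => proj S (Θ t)) (truncRhs v₀ ν k (ξ t) S (Θ t)) t)
    {R : ℝ → ℝ} {KR : NNReal} (hR : LipschitzOnWith KR R (Icc 0 T)) {M : ℝ}
    (hRM : ∀ t ∈ Icc 0 T, R t ≤ M)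
    (hRder : ∀ᵐ t, t ∈ Ioo 0 T → HasDerivAt R (decayRate ν |k| β (ξ t) (1 + ρ * t)) t)
    {s t : ℝ} (hs : 0 ≤ s) (hst : s ≤ t) (ht : t ≤ T) :
    hypoEnergy v₁ (gradWeight K ν |k| β ℓ (1 + ρ * t)) (crossWeight K |k| β (1 + ρ * t))
        (shearWeight K ν |k| β ℓ (1 + ρ * t)) k S (Θ t)
        * Real.exp (2 * ν * k ^ 2 * t + 1 / 4 * R t) ≤
      hypoEnergy v₁ (gradWeight K ν |k| β ℓ (1 + ρ * s)) (crossWeight K |k| β (1 + ρ * s))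
        (shearWeight K ν |k| β ℓ (1 + ρ * s)) k S (Θ s)
        * Real.exp (2 * ν * k ^ 2 * s + 1 / 4 * R s)
      + Real.exp (2 * ν * k ^ 2 * T + 1 / 4 * M) * ∫ τ in (0 : ℝ)..T,
          |k| * |Ξ| * (weightTotal v₁ K ν |k| β * forcing v₀ v₁ S (Θ τ)) := by
  have hν : 0 < ν := (hadm 0 ⟨le_rfl, hT⟩).ν_pos
  have hκ : 0 < |k| := (hadm 0 ⟨le_rfl, hT⟩).κ_pos
  have hβ : 0 < β := (hadm 0 ⟨le_rfl, hT⟩).β_pos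
  have hK0 : 0 < K := by linarith
  have hρc : ContDiff ℝ 1 fun t : ℝ => 2 * ν * k ^ 2 * t := by fun_prop
  obtain ⟨Kρ, hKρ⟩ := hρc.contDiffOn.exists_lipschitzOnWith (s := Icc 0 T) (by decide)
    (convex_Icc _ _) isCompact_Icc
  have hR4 : LipschitzOnWith (‖(1 / 4 : ℝ)‖₊ * KR) (fun t => 1 / 4 * R t) (Icc 0 T) :=
    (lipschitzWith_smul (1 / 4 : ℝ)).comp_lipschitzOnWith hR
  have hexp := hKρ.add hR4
  have hLipD : LipschitzOnWith (‖der S‖₊ * Ku) (fun t => der S (Θ t)) (Icc 0 T) := by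
    simpa only [der_proj] using hLip.clm_torus (der S)
  have hLipM := hLip.clm_torus (mulLp v₁)
  have hac : AbsolutelyContinuousOnInterval (fun t => hypoEnergy v₁
      (gradWeight K ν |k| β ℓ (1 + ρ * t)) (crossWeight K |k| β (1 + ρ * t))
      (shearWeight K ν |k| β ℓ (1 + ρ * t)) k S (Θ t)) 0 T := by
    unfold hypoEnergy
    simp only [← re_inner_self_torus]
    refine (((absolutelyContinuous_re_inner hT hLip hLip).const_mul _).fun_add
      (AbsolutelyContinuousOnInterval.fun_mul ?_
        (absolutelyContinuous_re_inner hT hLipD hLipD))).fun_add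
      (AbsolutelyContinuousOnInterval.fun_mul ?_
        (absolutelyContinuous_im_inner hT hLipM hLipD)) |>.fun_add
      (AbsolutelyContinuousOnInterval.fun_mul ?_
        (absolutelyContinuous_re_inner hT hLipM hLipM))
    · exact (absolutelyContinuous_affine_rpow hρ hT _ _).const_mul _
    · simp only [mul_comm _ k]
      exact (absolutelyContinuous_affine_rpow hρ hT _ _).const_mul _
    · simp only [mul_comm _ (k ^ 2)]
      exact ((absolutelyContinuous_affine_rpow hρ hT _ _).const_mul _).const_mul _
  have hW0 : 0 ≤ weightTotal v₁ K ν |k| β := by rw [weightTotal]; positivity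
  have hce : ContinuousOn (fun τ => |k| * |Ξ| * (weightTotal v₁ K ν |k| β *
      forcing v₀ v₁ S (Θ τ))) (uIcc 0 T) := by
    rw [uIcc_of_le hT]
    exact (((continuous_forcing v₀ v₁ S).comp_continuousOn hΘ).const_smul
      (weightTotal v₁ K ν |k| β)).const_smul (|k| * |Ξ|)
  have := gronwall_integrated (M := 2 * ν * k ^ 2 * T + 1 / 4 * M) (d := fun _ => 0) hT hac hexp
    (fun t ht => add_le_add (mul_le_mul_of_nonneg_left ht.2 (by positivity))
      (mul_le_mul_of_nonneg_left (hRM t ht) (by norm_num))) continuousOn_const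
    hce.intervalIntegrable
    (fun τ => mul_nonneg (by positivity) (mul_nonneg hW0 (forcing_nonneg _ _ _ _))) ?_ hs hst ht
  · simpa using this
  · filter_upwards [hder, hRder] with τ h1 hR1 h2
    have h3 := h1 h2
    have h3' := hR1 h2
    have hτ := Ioo_subset_Icc_self h2
    have hx := hξ τ hτ
    have had := hadm τ hτ
    have hq := had.q_pos
    have hq1 := had.q_ge
    have hD : HasDerivAt (fun t => der S (Θ t)) (der S (truncRhs v₀ ν k (ξ τ) S (Θ τ))) τ := by
      simpa only [der_proj] using h3.clm_torus (der S)
    have hM1 := h3.clm_torus (mulLp v₁)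
    have hℓ := had.ℓ_mem
    have da := hasDerivAt_affine_rpow (t := τ) (K / 2 * (√ν * √β / √|k|)) (-(1 + ℓ / 2)) hq
    have db := hasDerivAt_affine_rpow (t := τ) (K ^ 2 * (β / |k|)) (-2 : ℝ) hq
    have dc := hasDerivAt_affine_rpow (t := τ) (8 * K ^ 3 * (√β ^ 3 / (√|k| ^ 3 * √ν)))
      (-(3 - ℓ / 2)) hq
    refine ⟨hypoRate v₀ v₁ (gradWeight K ν |k| β ℓ (1 + ρ * τ)) (crossWeight K |k| β (1 + ρ * τ))
      (shearWeight K ν |k| β ℓ (1 + ρ * τ))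
      (-(1 + ℓ / 2) * (ρ / (1 + ρ * τ)) * gradWeight K ν |k| β ℓ (1 + ρ * τ))
      (-2 * (ρ / (1 + ρ * τ)) * crossWeight K |k| β (1 + ρ * τ))
      (-(3 - ℓ / 2) * (ρ / (1 + ρ * τ)) * shearWeight K ν |k| β ℓ (1 + ρ * τ)) ν k (ξ τ) S (Θ τ),
      2 * ν * k ^ 2 + 1 / 4 * decayRate ν |k| β (ξ τ) (1 + ρ * τ), ?_, ?_, ?_⟩
    · unfold hypoEnergy
      simp only [← re_inner_self_torus]
      have := ((((hasDerivAt_re_inner h3 h3).const_mul (1 / 2 : ℝ)).fun_add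
        ((da.const_mul (1 / 2 : ℝ)).fun_mul (hasDerivAt_re_inner hD hD))).fun_add
        ((db.mul_const k).fun_mul (hasDerivAt_im_inner hM1 hD))).fun_add
        (((dc.const_mul (1 / 2 : ℝ)).mul_const (k ^ 2)).fun_mul (hasDerivAt_re_inner hM1 hM1))
      convert! this using 1
      rw [re_inner_symm_torus (truncRhs v₀ ν k (ξ τ) S (Θ τ)),
        re_inner_symm_torus (der S (truncRhs v₀ ν k (ξ τ) S (Θ τ))),
        re_inner_symm_torus (mulLp v₁ (truncRhs v₀ ν k (ξ τ) S (Θ τ)))]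
      rw [hypoRate, gradWeight, crossWeight, shearWeight, re_inner_self_torus, re_inner_self_torus]
      rw [← re_inner_self_torus (der S (Θ τ))]
      ring
    · have h5 : HasDerivAt (fun t : ℝ => 2 * ν * k ^ 2 * t) (2 * ν * k ^ 2) τ := by
        simpa using (hasDerivAt_id τ).const_mul (2 * ν * k ^ 2)
      exact h5.fun_add (h3'.const_mul (1 / 4))
    · obtain ⟨c1, c2, c3, c4, c5⟩ := had.weight_conditions (m := ‖v₂‖) hK hC1 hC2
      have hI := had.coercivity hK (U := ‖proj S (Θ τ)‖) (X := ‖der S (Θ τ)‖)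
        (Y := ‖mulLp v₁ (proj S (Θ τ))‖) (fun σ h0 h1 => by
          have := hint S (proj S (Θ τ)) (proj_proj _ _) σ h0 h1
          rwa [der_proj] at this)
      have hk0 : 0 < √|k| := Real.sqrt_pos.2 hκ
      have hν0 : 0 < √ν := Real.sqrt_pos.2 hν
      have hβ0 : 0 < √β := Real.sqrt_pos.2 hβ
      have pa : 0 < gradWeight K ν |k| β ℓ (1 + ρ * τ) := by rw [gradWeight]; positivity
      have pb : 0 < crossWeight K |k| β (1 + ρ * τ) := by rw [crossWeight]; positivity
      have pc : 0 < shearWeight K ν |k| β ℓ (1 + ρ * τ) := by rw [shearWeight]; positivity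
      have hρq : 0 ≤ ρ / (1 + ρ * τ) := by positivity
      have hr0 : 0 ≤ decayRate ν |k| β (ξ τ) (1 + ρ * τ) := decayRate_nonneg hq.le
      have main := hypoRate_le (v₀ := v₀)
        (a' := -(1 + ℓ / 2) * (ρ / (1 + ρ * τ)) * gradWeight K ν |k| β ℓ (1 + ρ * τ))
        (b' := -2 * (ρ / (1 + ρ * τ)) * crossWeight K |k| β (1 + ρ * τ))
        (c' := -(3 - ℓ / 2) * (ρ / (1 + ρ * τ)) * shearWeight K ν |k| β ℓ (1 + ρ * τ))
        H₁ hν pa pb pc hx.1 hr0 hI c1 c2.le c3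
        (by linarith) c4 c5 ?_ ?_ ?_
      · refine main.trans ?_
        have ga : gradWeight K ν |k| β ℓ (1 + ρ * τ) ≤ K / 2 * (√ν * √β / √|k|) := by
          rw [gradWeight]
          exact mul_le_of_le_one_right (by positivity)
            (Real.rpow_le_one_of_one_le_of_nonpos hq1 (by linarith [hℓ.1]))
        have gb : crossWeight K |k| β (1 + ρ * τ) ≤ K ^ 2 * (β / |k|) := by
          rw [crossWeight]
          exact mul_le_of_le_one_right (by positivity)
            (Real.rpow_le_one_of_one_le_of_nonpos hq1 (by norm_num))
        have gc : shearWeight K ν |k| β ℓ (1 + ρ * τ) ≤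
            8 * K ^ 3 * (√β ^ 3 / (√|k| ^ 3 * √ν)) := by
          rw [shearWeight]
          exact mul_le_of_le_one_right (by positivity)
            (Real.rpow_le_one_of_one_le_of_nonpos hq1 (by linarith [hℓ.2]))
        have hf := forcing_nonneg v₀ v₁ S (Θ τ)
        have hΞ := hx.2.trans (le_abs_self Ξ)
        have g1 : |k| * ξ τ * ((1 + gradWeight K ν |k| β ℓ (1 + ρ * τ)
            + |k| * crossWeight K |k| β (1 + ρ * τ) * ‖v₁‖
            + shearWeight K ν |k| β ℓ (1 + ρ * τ) * k ^ 2 * ‖v₁‖ ^ 2) * forcing v₀ v₁ S (Θ τ)) ≤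
            |k| * |Ξ| * (weightTotal v₁ K ν |k| β * forcing v₀ v₁ S (Θ τ)) := by
          rw [weightTotal, sq_abs]
          gcongr
        rw [← forcing]
        linarith
      · have : 0 ≤ (1 + ℓ / 2) * (ρ / (1 + ρ * τ)) * gradWeight K ν |k| β ℓ (1 + ρ * τ) := by
          have := hℓ.1
          positivity
        linarith
      · have h3ℓ : 0 ≤ 3 - ℓ / 2 := by linarith [hℓ.2]
        have : 0 ≤ (3 - ℓ / 2) * (ρ / (1 + ρ * τ)) * shearWeight K ν |k| β ℓ (1 + ρ * τ) := by
          positivity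
        linarith
      -- By 4b² = ac one has b'² = (ρ/q)²ac, so b'² ≤ a'c' reduces to (1 + ℓ/2)(3 − ℓ/2) ≥ 1, true
      -- on [2, 4].
      · have h1ℓ : 1 ≤ (1 + ℓ / 2) * (3 - ℓ / 2) := by nlinarith [hℓ.1, hℓ.2]
        calc (-2 * (ρ / (1 + ρ * τ)) * crossWeight K |k| β (1 + ρ * τ)) ^ 2
            = 1 * ((ρ / (1 + ρ * τ)) ^ 2 * (gradWeight K ν |k| β ℓ (1 + ρ * τ)
              * shearWeight K ν |k| β ℓ (1 + ρ * τ))) := by rw [← c2]; ring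
          _ ≤ ((1 + ℓ / 2) * (3 - ℓ / 2)) * ((ρ / (1 + ρ * τ)) ^ 2 *
              (gradWeight K ν |k| β ℓ (1 + ρ * τ) * shearWeight K ν |k| β ℓ (1 + ρ * τ))) := by
            gcongr
          _ = _ := by ring

end TruncatedEstimates

/-! ### Commutator errors vanish in the limit. -/

section VanishingErrors

variable {T : ℝ} {v₀ v₁ v₂ : C(Torus, ℝ)}

/-- Truncations converge strongly to the identity, and the Leibniz rule brings the differentiated
commutator to the same form, so one weak derivative of f suffices. -/
lemma tendsto_forcing (H₀ : HasTorusDeriv v₀ v₁) {f g : TorusL2}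
    (hfg : ∀ S, der S f = proj S g) : Tendsto (fun S => forcing v₀ v₁ S f) atTop (𝓝 0) := by
  have hM : ∀ (h : C(Torus, ℝ)) (w : TorusL2),
      Tendsto (fun S => mulLp h (proj S w)) atTop (𝓝 (mulLp h w)) := fun h w =>
    ((mulLp h).continuous.tendsto w).comp (tendsto_proj w)
  have h1 : Tendsto (fun S => commDefect v₀ S f) atTop (𝓝 0) := by
    simpa [commDefect] using (hM v₀ f).sub (tendsto_proj (mulLp v₀ f))
  have h2 : Tendsto (fun S => commDefectDeriv v₀ v₁ S f) atTop (𝓝 0) := by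
    have := ((hM v₁ f).add (hM v₀ g)).sub (tendsto_proj (mulLp v₁ f + mulLp v₀ g))
    rw [sub_self] at this
    refine this.congr fun S => ?_
    rw [commDefectDeriv, hfg, H₀.der_mulLp S hfg]
  have h3 : Tendsto (fun S => defectSize v₀ v₁ S f) atTop (𝓝 0) := by
    simpa [defectSize] using h1.norm.add h2.norm
  have h4 : Tendsto (fun S => ‖proj S f‖ + ‖der S f‖) atTop (𝓝 (‖f‖ + ‖g‖)) := by
    simp only [hfg]
    exact (tendsto_proj f).norm.add (tendsto_proj g).norm
  simpa [forcing] using h4.mul h3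

/-- A bound uniform in `S`, integrable in time along a weak solution, for dominated convergence. -/
lemma forcing_le (H₀ : HasTorusDeriv v₀ v₁) {f g : TorusL2} (hfg : ∀ S, der S f = proj S g)
    (S : Finset ℤ) :
    forcing v₀ v₁ S f ≤ 8 * (‖v₀‖ + ‖v₁‖) * (‖f‖ ^ 2 + ‖g‖ ^ 2) := by
  have h1 : ‖commDefect v₀ S f‖ ≤ 2 * (‖v₀‖ * ‖f‖) := by
    rw [commDefect]
    refine (norm_sub_le _ _).trans ?_
    have a1 : ‖mulLp v₀ (proj S f)‖ ≤ ‖v₀‖ * ‖f‖ := (norm_mulLp_le _ _).trans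
      (mul_le_mul_of_nonneg_left (norm_proj_le S f) (norm_nonneg _))
    have a2 : ‖proj S (mulLp v₀ f)‖ ≤ ‖v₀‖ * ‖f‖ := (norm_proj_le _ _).trans (norm_mulLp_le _ _)
    linarith
  have h2 : ‖commDefectDeriv v₀ v₁ S f‖ ≤ 2 * (‖v₁‖ * ‖f‖ + ‖v₀‖ * ‖g‖) := by
    rw [commDefectDeriv, hfg, H₀.der_mulLp S hfg]
    refine (norm_sub_le _ _).trans ?_
    have a1 : ‖mulLp v₁ (proj S f)‖ ≤ ‖v₁‖ * ‖f‖ := (norm_mulLp_le _ _).trans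
      (mul_le_mul_of_nonneg_left (norm_proj_le S f) (norm_nonneg _))
    have a2 : ‖mulLp v₀ (proj S g)‖ ≤ ‖v₀‖ * ‖g‖ := (norm_mulLp_le _ _).trans
      (mul_le_mul_of_nonneg_left (norm_proj_le S g) (norm_nonneg _))
    have a3 := norm_add_le (mulLp v₁ (proj S f)) (mulLp v₀ (proj S g))
    have a4 := (norm_proj_le S (mulLp v₁ f + mulLp v₀ g)).trans ((norm_add_le _ _).trans
      (add_le_add (norm_mulLp_le v₁ f) (norm_mulLp_le v₀ g)))
    linarith
  have h3 : ‖proj S f‖ + ‖der S f‖ ≤ ‖f‖ + ‖g‖ := by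
    rw [hfg]; exact add_le_add (norm_proj_le S f) (norm_proj_le S g)
  have hv0 := norm_nonneg v₀
  have hv1 := norm_nonneg v₁
  have hf := norm_nonneg f
  have hg := norm_nonneg g
  have h4 : defectSize v₀ v₁ S f ≤ 4 * (‖v₀‖ + ‖v₁‖) * (‖f‖ + ‖g‖) := by
    rw [defectSize]
    have := mul_nonneg hv0 hf
    have := mul_nonneg hv0 hg
    have := mul_nonneg hv1 hf
    have := mul_nonneg hv1 hg
    linarith
  calc forcing v₀ v₁ S f ≤ (‖f‖ + ‖g‖) * (4 * (‖v₀‖ + ‖v₁‖) * (‖f‖ + ‖g‖)) := by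
        rw [forcing]
        exact mul_le_mul h3 h4 (by rw [defectSize]; positivity) (by positivity)
    _ = (‖v₀‖ + ‖v₁‖) * (4 * (‖f‖ + ‖g‖) ^ 2) := by ring
    _ ≤ (‖v₀‖ + ‖v₁‖) * (8 * (‖f‖ ^ 2 + ‖g‖ ^ 2)) := by
        refine mul_le_mul_of_nonneg_left ?_ (by positivity)
        linarith [add_sq_le (a := ‖f‖) (b := ‖g‖)]
    _ = _ := by ring

lemma tendsto_integral_forcing (H₀ : HasTorusDeriv v₀ v₁) (hT : 0 ≤ T) {Θ D : ℝ → TorusL2}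
    (hΘ : ContinuousOn Θ (Icc 0 T)) (hD : MemLp D 2 (volume.restrict (Icc 0 T)))
    (hw : ∀ᵐ t ∂(volume.restrict (Icc 0 T)), IsWeakDeriv (Θ t) (D t)) :
    Tendsto (fun S => ∫ τ in (0 : ℝ)..T, forcing v₀ v₁ S (Θ τ)) atTop (𝓝 0) := by
  rw [ae_restrict_iff' measurableSet_Icc] at hw
  have hcont : ∀ S, ContinuousOn (fun τ => forcing v₀ v₁ S (Θ τ)) (Icc 0 T) := fun S =>
    (continuous_forcing v₀ v₁ S).comp_continuousOn hΘ
  have hΙ : uIoc 0 T ⊆ Icc 0 T := by rw [uIoc_of_le hT]; exact Ioc_subset_Icc_self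
  have hbound : IntervalIntegrable
      (fun τ => 8 * (‖v₀‖ + ‖v₁‖) * (‖Θ τ‖ ^ 2 + ‖D τ‖ ^ 2)) volume 0 T := by
    rw [intervalIntegrable_iff_integrableOn_Icc_of_le hT]
    refine Integrable.const_mul (Integrable.add ?_ ?_) _
    · exact (hΘ.norm.pow 2).integrableOn_Icc
    · exact hD.norm.integrable_sq
  have := intervalIntegral.tendsto_integral_filter_of_dominated_convergence
    (μ := volume) (a := 0) (b := T) (l := atTop)
    (F := fun S τ => forcing v₀ v₁ S (Θ τ)) (f := fun _ => 0) _
    (Eventually.of_forall fun S =>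
      ((hcont S).aestronglyMeasurable measurableSet_Icc).mono_set hΙ)
    (Eventually.of_forall fun S => by
      filter_upwards [hw] with τ h1 h2
      rw [Real.norm_of_nonneg (forcing_nonneg _ _ _ _)]
      exact forcing_le H₀ (h1 (hΙ h2)).der_eq S) hbound
    (by
      filter_upwards [hw] with τ h1 h2
      exact tendsto_forcing H₀ (h1 (hΙ h2)).der_eq)
  simpa using this

end VanishingErrors

/-! ### Primitives of bounded nonnegative rates. -/

section Primitive

variable {r : ℝ → ℝ} {T B : ℝ}

lemma intervalIntegrable_of_bounded (hT : 0 ≤ T)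
    (hm : AEStronglyMeasurable r (volume.restrict (Icc 0 T)))
    (hr : ∀ t ∈ Icc 0 T, 0 ≤ r t ∧ r t ≤ B) : IntervalIntegrable r volume 0 T := by
  rw [intervalIntegrable_iff_integrableOn_Icc_of_le hT]
  refine Integrable.of_bound (μ := volume.restrict (Icc 0 T)) hm B ?_
  rw [ae_restrict_iff' measurableSet_Icc]
  refine Eventually.of_forall fun t ht => ?_
  rw [Real.norm_of_nonneg (hr t ht).1]
  exact (hr t ht).2

lemma intervalIntegrable_sub (hT : 0 ≤ T) (hi : IntervalIntegrable r volume 0 T) {s t : ℝ}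
    (hs : s ∈ Icc 0 T) (ht : t ∈ Icc 0 T) : IntervalIntegrable r volume s t :=
  hi.mono_set (by rw [uIcc_of_le hT]; exact uIcc_subset_Icc hs ht)

lemma lipschitzOnWith_primitive (hT : 0 ≤ T)
    (hm : AEStronglyMeasurable r (volume.restrict (Icc 0 T)))
    (hr : ∀ t ∈ Icc 0 T, 0 ≤ r t ∧ r t ≤ B) :
    LipschitzOnWith B.toNNReal (fun t => ∫ τ in (0 : ℝ)..t, r τ) (Icc 0 T) := by
  have h0 : (0 : ℝ) ∈ Icc 0 T := ⟨le_rfl, hT⟩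
  have hB : 0 ≤ B := (hr 0 h0).1.trans (hr 0 h0).2
  have hi := intervalIntegrable_of_bounded hT hm hr
  refine LipschitzOnWith.of_dist_le_mul fun s hs t ht => ?_
  rw [Real.coe_toNNReal _ hB, dist_eq_norm, Real.dist_eq,
    intervalIntegral.integral_interval_sub_left (intervalIntegrable_sub hT hi h0 hs)
      (intervalIntegrable_sub hT hi h0 ht)]
  refine intervalIntegral.norm_integral_le_of_norm_le_const fun τ hτ => ?_
  have hτ' := uIcc_subset_Icc ht hs (uIoc_subset_uIcc hτ)
  rw [Real.norm_of_nonneg (hr τ hτ').1]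
  exact (hr τ hτ').2

lemma primitive_mono (hT : 0 ≤ T)
    (hm : AEStronglyMeasurable r (volume.restrict (Icc 0 T)))
    (hr : ∀ t ∈ Icc 0 T, 0 ≤ r t ∧ r t ≤ B) {s t : ℝ} (hs : 0 ≤ s) (hst : s ≤ t) (ht : t ≤ T) :
    ∫ τ in (0 : ℝ)..s, r τ ≤ ∫ τ in (0 : ℝ)..t, r τ := by
  have h0 : (0 : ℝ) ∈ Icc 0 T := ⟨le_rfl, hT⟩
  have hi := intervalIntegrable_of_bounded hT hm hr
  rw [← sub_nonneg, intervalIntegral.integral_interval_sub_left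
    (intervalIntegrable_sub hT hi h0 ⟨hs.trans hst, ht⟩)
    (intervalIntegrable_sub hT hi h0 ⟨hs, hst.trans ht⟩)]
  exact intervalIntegral.integral_nonneg hst fun τ hτ => (hr τ ⟨hs.trans hτ.1, hτ.2.trans ht⟩).1

lemma ae_hasDerivAt_primitive (hT : 0 ≤ T)
    (hm : AEStronglyMeasurable r (volume.restrict (Icc 0 T)))
    (hr : ∀ t ∈ Icc 0 T, 0 ≤ r t ∧ r t ≤ B) :
    ∀ᵐ t, t ∈ Ioo 0 T → HasDerivAt (fun t => ∫ τ in (0 : ℝ)..t, r τ) (r t) t := by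
  filter_upwards [(intervalIntegrable_of_bounded hT hm hr).ae_hasDerivAt_integral] with t h1 ht
  exact h1 (by rw [uIcc_of_le hT]; exact Ioo_subset_Icc_self ht) 0 left_mem_uIcc

end Primitive

/-! ### Averaging over the initial layer and decay of the truncations. -/

section Decay

/-- Averaging an exponential decay estimate over the initial layer `{R ≤ 1}` against the rate. -/
lemma decay_of_averaging {T t δ₁ δ₂ A E₀ Z : ℝ} {r R d F N : ℝ → ℝ}
    (ht : t ∈ Icc 0 T) (hr : ∀ s ∈ Icc 0 T, 0 ≤ r s) (hri : IntervalIntegrable r volume 0 T)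
    (hR : ∀ s, R s = ∫ τ in (0 : ℝ)..s, r τ) (hRc : ContinuousOn R (Icc 0 T))
    (hRm : ∀ s₁ s₂, 0 ≤ s₁ → s₁ ≤ s₂ → s₂ ≤ T → R s₁ ≤ R s₂)
    (hdc : ContinuousOn d (Icc 0 T)) (hd : ∀ s ∈ Icc 0 T, 0 ≤ d s)
    (hA : 1 ≤ A) (hE₀ : 0 ≤ E₀) (hδ₁ : 0 ≤ δ₁) (hδ₂ : 0 ≤ δ₂)
    (hN : ∀ s ∈ Icc 0 T, N s + 2 * ∫ τ in (0 : ℝ)..s, d τ ≤ E₀ + 2 * δ₁)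
    (hZ : Z ≤ N t * Real.exp (1 / 4 * R t))
    (hN0 : ∀ s ∈ Icc 0 T, 0 ≤ N s)
    (hF0 : ∀ s ∈ Icc 0 T, 0 ≤ F s)
    (hF : ∀ s, 0 ≤ s → s ≤ t → 1 / 2 * Z ≤ F s * Real.exp (1 / 4 * R s) + δ₂)
    (hrF : ∀ s ∈ Icc 0 T, r s * F s ≤ r s * (A * N s) + d s) :
    Z ≤ 2 * Real.exp (1 / 4) * (1 + A) * (E₀ + 2 * δ₁) + 2 * δ₂ := by
  have hint0 : ∀ s ∈ Icc 0 T, 0 ≤ ∫ τ in (0 : ℝ)..s, d τ := fun s hs =>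
    intervalIntegral.integral_nonneg hs.1 fun τ hτ => hd τ ⟨hτ.1, hτ.2.trans hs.2⟩
  have hNle : ∀ s ∈ Icc 0 T, N s ≤ E₀ + 2 * δ₁ := fun s hs => by
    linarith [hN s hs, hint0 s hs]
  have hexp : (0 : ℝ) < Real.exp (1 / 4) := Real.exp_pos _
  have hpos : 0 ≤ E₀ + 2 * δ₁ := by positivity
  -- While R(t) ≤ 1 the factor exp(R/4) is bounded and the energy estimate alone suffices.
  rcases le_total (R t) 1 with h1 | h1
  · have h2 : Real.exp (1 / 4 * R t) ≤ Real.exp (1 / 4) := Real.exp_le_exp.2 (by linarith)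
    have h3 : N t * Real.exp (1 / 4 * R t) ≤ (E₀ + 2 * δ₁) * Real.exp (1 / 4) :=
      mul_le_mul (hNle t ht) h2 (Real.exp_pos _).le hpos
    have h4 : 0 ≤ Real.exp (1 / 4) * (E₀ + 2 * δ₁) := by positivity
    have h5 : 0 ≤ Real.exp (1 / 4) * (E₀ + 2 * δ₁) * A := by positivity
    linarith
  · have hR0 : R 0 = 0 := by rw [hR, intervalIntegral.integral_same]
    have hT : 0 ≤ T := ht.1.trans ht.2
    -- At R(t₀) = 1 the density r has mass one on [0, t₀]. Integrating `hF` against it leaves Z/2 on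
    -- the left, while `hrF` turns r F into r N, bounded by the energy, and d, whose integral the
    -- energy estimate pays for.
    obtain ⟨t₀, ht₀, hRt₀⟩ := intermediate_value_Icc ht.1 (hRc.mono (Icc_subset_Icc le_rfl ht.2))
      (show (1 : ℝ) ∈ Icc (R 0) (R t) from ⟨by rw [hR0]; exact zero_le_one, h1⟩)
    have ht₀T : t₀ ∈ Icc 0 T := ⟨ht₀.1, ht₀.2.trans ht.2⟩
    have hsub : uIcc 0 t₀ ⊆ uIcc 0 T := by
      rw [uIcc_of_le ht₀.1, uIcc_of_le hT]; exact Icc_subset_Icc le_rfl ht₀T.2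
    have ir : IntervalIntegrable r volume 0 t₀ := hri.mono_set hsub
    have id' : IntervalIntegrable d volume 0 t₀ := by
      refine ContinuousOn.intervalIntegrable (hdc.mono ?_)
      rw [uIcc_of_le ht₀.1]; exact Icc_subset_Icc le_rfl ht₀T.2
    have hmono := intervalIntegral.integral_mono_on ht₀.1 (ir.mul_const (1 / 2 * Z))
      ((ir.mul_const (Real.exp (1 / 4) * (A * (E₀ + 2 * δ₁)) + δ₂)).add
        (id'.const_mul (Real.exp (1 / 4)))) (fun s hs => by
        have hsT : s ∈ Icc 0 T := ⟨hs.1, hs.2.trans ht₀T.2⟩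
        have hrs := hr s hsT
        have k1 : R s ≤ 1 := hRt₀ ▸ hRm s t₀ hs.1 hs.2 ht₀T.2
        have k2 : Real.exp (1 / 4 * R s) ≤ Real.exp (1 / 4) := Real.exp_le_exp.2 (by linarith)
        have k3 := hF s hs.1 (hs.2.trans ht₀.2)
        have k4 : F s * Real.exp (1 / 4 * R s) ≤ F s * Real.exp (1 / 4) :=
          mul_le_mul_of_nonneg_left k2 (hF0 s hsT)
        have k5 := mul_le_mul_of_nonneg_left (k3.trans (add_le_add_left k4 δ₂)) hrs
        have k6 := mul_le_mul_of_nonneg_left (hrF s hsT) hexp.le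
        have k7 := mul_le_mul_of_nonneg_left
          (mul_le_mul_of_nonneg_left (hNle s hsT) (by linarith : 0 ≤ A))
          (mul_nonneg hexp.le hrs)
        linarith)
    rw [intervalIntegral.integral_add (ir.mul_const _) (id'.const_mul _),
      intervalIntegral.integral_mul_const, intervalIntegral.integral_mul_const,
      intervalIntegral.integral_const_mul, ← hR, hRt₀] at hmono
    have h2 := hN t₀ ht₀T
    have h3 : ∫ τ in (0 : ℝ)..t₀, d τ ≤ 1 / 2 * (E₀ + 2 * δ₁) := by
      linarith [hN0 t₀ ht₀T]
    have h4 := mul_le_mul_of_nonneg_left h3 hexp.le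
    have h5 : 0 ≤ Real.exp (1 / 4) * (E₀ + 2 * δ₁) := by positivity
    linarith

variable {ν T Ξ β ℓ ρ C K : ℝ} {k : ℝ} {ξ : ℝ → ℝ} {v₀ v₁ v₂ : C(Torus, ℝ)} {Θ : ℝ → TorusL2}
  {S : Finset ℤ} {Ku : NNReal}

/-- The gradient term is affordable because r a ≤ ν. The constant 6 is ¾ · 8, from `hypoEnergy_le`
and `Admissible.shearWeight_mul_le`. -/
lemma Admissible.decayRate_mul_hypoEnergy_le {x q : ℝ} (h : Admissible C ν |k| β ℓ x q)
    (hK : 1 ≤ K) (hC1 : 8 * K ≤ C) (hC2 : 136 * K ^ 3 * ‖v₂‖ ^ 2 ≤ C) (S : Finset ℤ)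
    (g : TorusL2) :
    decayRate ν |k| β x q * hypoEnergy v₁ (gradWeight K ν |k| β ℓ q) (crossWeight K |k| β q)
        (shearWeight K ν |k| β ℓ q) k S g ≤
      decayRate ν |k| β x q * ((1 + 6 * K ^ 3 * ‖v₁‖ ^ 2 * √(|k| / ν)) * ‖proj S g‖ ^ 2)
        + ν * ‖der S g‖ ^ 2 := by
  obtain ⟨-, c2, -, c4, -⟩ := h.weight_conditions (m := ‖v₂‖) hK hC1 hC2
  have hq := h.q_pos
  have hK0 : 0 < K := by linarith
  have pa : 0 ≤ gradWeight K ν |k| β ℓ q := by rw [gradWeight]; positivity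
  have pc : 0 ≤ shearWeight K ν |k| β ℓ q := by rw [shearWeight]; positivity
  have hr0 : 0 ≤ decayRate ν |k| β x q := decayRate_nonneg hq.le
  have h1 := mul_le_mul_of_nonneg_left
    (hypoEnergy_le (v₁ := v₁) (k := k) pa pc c2.le S g) hr0
  have h2 := h.shearWeight_mul_le (by linarith) hK
  have h3 := mul_le_mul_of_nonneg_right c4 (sq_nonneg ‖der S g‖)
  have h4 : ‖mulLp v₁ (proj S g)‖ ^ 2 ≤ ‖v₁‖ ^ 2 * ‖proj S g‖ ^ 2 := by
    rw [← mul_pow]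
    exact pow_le_pow_left₀ (norm_nonneg _) (norm_mulLp_le _ _) 2
  have h5 : shearWeight K ν |k| β ℓ q * |k| ^ 2 * ‖mulLp v₁ (proj S g)‖ ^ 2 ≤
      8 * K ^ 3 * √(|k| / ν) * (‖v₁‖ ^ 2 * ‖proj S g‖ ^ 2) := by gcongr
  have h6 := mul_le_mul_of_nonneg_left h5 hr0
  have h7 : 0 ≤ decayRate ν |k| β x q * ‖proj S g‖ ^ 2 := by positivity
  have h8 : 0 ≤ ν * ‖der S g‖ ^ 2 := by have := h.ν_pos; positivity
  linarith

/-- The constant `W` may depend on T and all parameters but not on `S`; this is enough because it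
multiplies an error that tends to 0. -/
lemma truncated_decay (H₁ : HasTorusDeriv v₁ v₂) (hT : 0 ≤ T)
    (hΘ : ContinuousOn Θ (Icc 0 T)) (hρ : 0 ≤ ρ)
    (hξm : AEStronglyMeasurable ξ (volume.restrict (Icc 0 T)))
    (hK : 1 ≤ K) (hC1 : 8 * K ≤ C) (hC2 : 136 * K ^ 3 * ‖v₂‖ ^ 2 ≤ C)
    (hint : ∀ (S : Finset ℤ) (u : TorusL2), proj S u = u → ∀ σ : ℝ, 0 < σ → σ ≤ 1 →
      σ * ‖u‖ ^ 2 ≤ K * (σ ^ 2 * ‖der S u‖ ^ 2 + ‖mulLp v₁ u‖ ^ 2))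
    (hadm : ∀ t ∈ Icc 0 T, Admissible C ν |k| β ℓ (ξ t) (1 + ρ * t))
    (hξ : ∀ t ∈ Icc 0 T, 0 ≤ ξ t ∧ ξ t ≤ Ξ) :
    ∃ W : ℝ, ∀ (S : Finset ℤ) (Ku : NNReal),
      LipschitzOnWith Ku (fun t => proj S (Θ t)) (Icc 0 T) →
      (∀ᵐ t, t ∈ Ioo 0 T →
        HasDerivAt (fun t => proj S (Θ t)) (truncRhs v₀ ν k (ξ t) S (Θ t)) t) →
      ∀ t ∈ Icc 0 T,
        ‖proj S (Θ t)‖ ^ 2 * Real.exp (2 * ν * k ^ 2 * t) *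
            Real.exp (1 / 4 * ∫ τ in (0 : ℝ)..t, decayRate ν |k| β (ξ τ) (1 + ρ * τ)) ≤
          2 * Real.exp (1 / 4) * (1 + (1 + 6 * K ^ 3 * ‖v₁‖ ^ 2 * √(|k| / ν))) *
            ‖proj S (Θ 0)‖ ^ 2 + W * ∫ τ in (0 : ℝ)..T, forcing v₀ v₁ S (Θ τ) := by
  have had0 := hadm 0 ⟨le_rfl, hT⟩
  have hν : 0 < ν := had0.ν_pos
  have hκ : 0 < |k| := had0.κ_pos
  have hβ : 0 < β := had0.β_pos
  have hK0 : 0 < K := by linarith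
  set r : ℝ → ℝ := fun τ => decayRate ν |k| β (ξ τ) (1 + ρ * τ) with hr_def
  set R : ℝ → ℝ := fun t => ∫ τ in (0 : ℝ)..t, r τ with hR_def
  have hrb : ∀ t ∈ Icc 0 T, 0 ≤ r t ∧ r t ≤ √(β * ν * |k|) * √Ξ := fun t ht => by
    have hq := (hadm t ht).q_ge
    refine ⟨decayRate_nonneg (by linarith), ?_⟩
    simp only [hr_def, decayRate]
    have h1 : √(ξ t) * (1 + ρ * t)⁻¹ ≤ √Ξ * 1 :=
      mul_le_mul (Real.sqrt_le_sqrt (hξ t ht).2) (inv_le_one_of_one_le₀ hq)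
        (by positivity) (by positivity)
    rw [mul_one] at h1
    gcongr
  have hrm : AEStronglyMeasurable r (volume.restrict (Icc 0 T)) := by
    have h1 : AEStronglyMeasurable (fun τ => √(ξ τ)) (volume.restrict (Icc 0 T)) :=
      Real.continuous_sqrt.comp_aestronglyMeasurable hξm
    have h2 : AEStronglyMeasurable (fun τ : ℝ => (1 + ρ * τ)⁻¹) (volume.restrict (Icc 0 T)) :=
      (by fun_prop : Measurable fun τ : ℝ => (1 + ρ * τ)⁻¹).aestronglyMeasurable
    exact (h1.mul h2).const_mul _
  have hri := intervalIntegrable_of_bounded hT hrm hrb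
  have hRL := lipschitzOnWith_primitive hT hrm hrb
  have hRm : ∀ s₁ s₂, 0 ≤ s₁ → s₁ ≤ s₂ → s₂ ≤ T → R s₁ ≤ R s₂ := fun s₁ s₂ h1 h2 h3 =>
    primitive_mono hT hrm hrb h1 h2 h3
  have hRder := ae_hasDerivAt_primitive hT hrm hrb
  refine ⟨2 * Real.exp (1 / 4) * (1 + (1 + 6 * K ^ 3 * ‖v₁‖ ^ 2 * √(|k| / ν))) *
      (2 * (Real.exp (2 * ν * k ^ 2 * T) * (|k| * |Ξ|)))
      + 2 * (Real.exp (2 * ν * k ^ 2 * T + 1 / 4 * R T) *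
        (|k| * |Ξ| * weightTotal v₁ K ν |k| β)), fun S Ku hLip hder t ht => ?_⟩
  set ε := ∫ τ in (0 : ℝ)..T, forcing v₀ v₁ S (Θ τ) with hε
  have hε0 : 0 ≤ ε := intervalIntegral.integral_nonneg hT fun τ _ => forcing_nonneg _ _ _ _
  have hW0 : 0 ≤ weightTotal v₁ K ν |k| β := by rw [weightTotal]; positivity
  have hpos : ∀ s ∈ Icc 0 T, 1 / 2 * ‖proj S (Θ s)‖ ^ 2 ≤
      hypoEnergy v₁ (gradWeight K ν |k| β ℓ (1 + ρ * s)) (crossWeight K |k| β (1 + ρ * s))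
        (shearWeight K ν |k| β ℓ (1 + ρ * s)) k S (Θ s) := fun s hs => by
    obtain ⟨-, c2, -⟩ := (hadm s hs).weight_conditions (m := ‖v₂‖) hK hC1 hC2
    have hq := (hadm s hs).q_pos
    exact half_norm_sq_le_hypoEnergy (by rw [gradWeight]; positivity)
      (by rw [shearWeight]; positivity) c2.le S (Θ s)
  have hexp0 : ∀ s, 0 < Real.exp (2 * ν * k ^ 2 * s) := fun s => Real.exp_pos _
  have hexpc : Continuous fun s : ℝ => Real.exp (2 * ν * k ^ 2 * s) := by fun_prop
  have main := decay_of_averaging (T := T) (t := t) (r := r) (R := R)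
    (d := fun s => ν * ‖der S (Θ s)‖ ^ 2 * Real.exp (2 * ν * k ^ 2 * s))
    (N := fun s => ‖proj S (Θ s)‖ ^ 2 * Real.exp (2 * ν * k ^ 2 * s))
    (F := fun s => hypoEnergy v₁ (gradWeight K ν |k| β ℓ (1 + ρ * s))
      (crossWeight K |k| β (1 + ρ * s)) (shearWeight K ν |k| β ℓ (1 + ρ * s)) k S (Θ s)
        * Real.exp (2 * ν * k ^ 2 * s))
    (A := 1 + 6 * K ^ 3 * ‖v₁‖ ^ 2 * √(|k| / ν)) (E₀ := ‖proj S (Θ 0)‖ ^ 2)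
    (δ₁ := Real.exp (2 * ν * k ^ 2 * T) * (|k| * |Ξ| * ε))
    (δ₂ := Real.exp (2 * ν * k ^ 2 * T + 1 / 4 * R T) *
      (|k| * |Ξ| * (weightTotal v₁ K ν |k| β * ε)))
    (Z := ‖proj S (Θ t)‖ ^ 2 * Real.exp (2 * ν * k ^ 2 * t) * Real.exp (1 / 4 * R t))
    ht (fun s hs => (hrb s hs).1) hri (fun s => rfl) hRL.continuousOn hRm
    (((((der S).continuous.comp_continuousOn hΘ).norm.pow 2).const_smul ν).mul
      hexpc.continuousOn)
    (fun s _ => by positivity) (le_add_of_nonneg_right (by positivity)) (by positivity)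
    (by positivity) (by positivity) ?_ le_rfl (fun s _ => by positivity)
    (fun s hs => mul_nonneg (le_trans (by positivity) (hpos s hs)) (hexp0 s).le) ?_ ?_
  · refine main.trans (le_of_eq ?_)
    ring
  · intro s hs
    have := truncated_energy_estimate (v₁ := v₁) hT hΘ hν.le hξ hLip hder hs
    rw [intervalIntegral.integral_const_mul] at this
    linarith
  · intro s hs hst
    have h1 := truncated_hypo_estimate H₁ hT hΘ hρ hK hC1 hC2 hint hadm hξ hLip hder hRL
      (M := R T) (fun τ hτ => hRm τ T hτ.1 hτ.2 le_rfl) hRder hs hst ht.2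
    rw [intervalIntegral.integral_const_mul, intervalIntegral.integral_const_mul, Real.exp_add,
      Real.exp_add] at h1
    have h2 := mul_le_mul_of_nonneg_right (hpos t ht)
      (by positivity : 0 ≤ Real.exp (2 * ν * k ^ 2 * t) * Real.exp (1 / 4 * R t))
    rw [← mul_assoc (hypoEnergy _ _ _ _ _ _ _) (Real.exp (2 * ν * k ^ 2 * s))] at h1
    linarith
  · intro s hs
    have h1 := mul_le_mul_of_nonneg_right
      ((hadm s hs).decayRate_mul_hypoEnergy_le (v₁ := v₁) hK hC1 hC2 S (Θ s)) (hexp0 s).le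
    simp only [hr_def]
    linarith

end Decay

/-! ### Translation of the hypotheses and removal of the truncation. -/

section MainTheorem

/-- The two branches of L cross where q equals P, with νP²/(κβ) = C²β², and L is their maximum.
Hence both lower bounds on ξ hold at all times. -/
lemma admissible_of_bounds {C ν s β ℓ T t : ℝ} {k : ℤ} {ξ : ℝ → ℝ} (hC : 0 < C) (hν : 0 < ν)
    (hν1 : ν ≤ 1) (hk : k ≠ 0) (hβ : β ∈ Icc (ν / |(k : ℝ)|) 1) (hℓ : ℓ ∈ Icc (2 : ℝ) 4)
    (hT : 0 < T)
    (hξ : ∀ t ∈ Icc 0 T, lowerBound C β ν k s t ≤ ξ t ∧ ξ t ≤ upperBound ν s ℓ t)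
    (ht : t ∈ Icc 0 T) :
    Admissible C ν |(k : ℝ)| β ℓ (ξ t) (1 + ν ^ s * t) := by
  have hρ : 0 < ν ^ s := Real.rpow_pos_of_pos hν s
  have hκ : (1 : ℝ) ≤ |(k : ℝ)| := by
    exact_mod_cast Int.one_le_abs hk
  have hκ0 : 0 < |(k : ℝ)| := by linarith
  have hβ0 : 0 < β := (div_pos hν hκ0).trans_le hβ.1
  have hq : ∀ t ∈ Icc 0 T, 1 ≤ 1 + ν ^ s * t := fun t ht => by
    have := mul_nonneg hρ.le ht.1
    linarith
  have key : ∀ t ∈ Icc 0 T, (C * β) ^ 2 ≤ ξ t ∧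
      ν / (|(k : ℝ)| * β) * (1 + ν ^ s * t) ^ 2 ≤ ξ t ∧ ξ t ≤ (1 + ν ^ s * t) ^ ℓ := by
    intro t ht
    obtain ⟨h1, h2⟩ := hξ t ht
    have hqt := hq t ht
    have hq0 : 0 < 1 + ν ^ s * t := by linarith
    have hw : weight ν s t ^ (-2 : ℝ) = (1 + ν ^ s * t) ^ 2 := by
      rw [weight, Real.inv_rpow hq0.le, Real.rpow_neg hq0.le, inv_inv, Real.rpow_two]
    have hu : upperBound ν s ℓ t = (1 + ν ^ s * t) ^ ℓ := by
      rw [upperBound, weight, Real.inv_rpow hq0.le, Real.rpow_neg hq0.le, inv_inv]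
    have hsw : (|(k : ℝ)| ^ (1 / 2 : ℝ) * C * β ^ (3 / 2 : ℝ) / ν ^ (1 / 2 : ℝ)) ^ 2
        = |(k : ℝ)| * β / ν * (C ^ 2 * β ^ 2) := by
      have e1 : (|(k : ℝ)| ^ (1 / 2 : ℝ)) ^ 2 = |(k : ℝ)| := by
        rw [← Real.sqrt_eq_rpow, Real.sq_sqrt hκ0.le]
      have e2 : (ν ^ (1 / 2 : ℝ)) ^ 2 = ν := by
        rw [← Real.sqrt_eq_rpow, Real.sq_sqrt hν.le]
      have e3 : (β ^ (3 / 2 : ℝ)) ^ 2 = β ^ 3 := by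
        rw [← Real.rpow_natCast (β ^ (3 / 2 : ℝ)) 2, ← Real.rpow_mul hβ0.le,
          ← Real.rpow_natCast β 3]
        norm_num
      rw [div_pow, mul_pow, mul_pow, e1, e2, e3]
      ring
    set P := |(k : ℝ)| ^ (1 / 2 : ℝ) * C * β ^ (3 / 2 : ℝ) / ν ^ (1 / 2 : ℝ) with hP
    have hP0 : 0 ≤ P := by positivity
    have hst : t ≤ switchTime C β ν k s ↔ 1 + ν ^ s * t ≤ P := by
      rw [switchTime, ← hP, one_div, ← div_eq_inv_mul, le_div_iff₀ hρ]
      constructor <;> intro h <;> linarith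
    rw [hu] at h2
    rw [lowerBound, hw] at h1
    have hfac : 0 < ν / (|(k : ℝ)| * β) := by positivity
    have hcomb : ν / (|(k : ℝ)| * β) * P ^ 2 = C ^ 2 * β ^ 2 := by
      rw [hsw]; field_simp
    split_ifs at h1 with hc
    · have h3 := pow_le_pow_left₀ hq0.le (hst.1 hc) 2
      have h4 := mul_le_mul_of_nonneg_left h3 hfac.le
      exact ⟨by rw [mul_pow]; exact h1, by linarith, h2⟩
    · have h3 := pow_le_pow_left₀ hP0 (not_le.1 fun h => hc (hst.2 h)).le 2
      have h4 := mul_le_mul_of_nonneg_left h3 hfac.le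
      exact ⟨by rw [mul_pow]; linarith, h1, h2⟩
  -- At time zero the bounds read C²β² ≤ ξ(0) ≤ 1, which forces β to be small.
  have hCβ : C * β ≤ 1 := by
    obtain ⟨h1, -, h2⟩ := key 0 ⟨le_rfl, hT.le⟩
    rw [mul_zero, add_zero, Real.one_rpow] at h2
    by_contra! hlt
    nlinarith
  obtain ⟨h1, h2, h3⟩ := key t ht
  exact ⟨hν, hν1, hκ, hβ.1, hCβ, hℓ, hq t ht, h1, h2, h3⟩

theorem theorem1 (v : Torus → ℝ) (hv : IsSimpleShear v) :
    ∃ C : ℝ, 0 < C ∧ ∃ Ced : ℝ, 0 < Ced ∧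
      ∀ (ν : ℝ) (k : ℤ) (s β ℓ T : ℝ) (ξ : ℝ → ℝ) (Θ₀ : TorusL2) (Θ : ℝ → TorusL2),
        0 < ν → ν ≤ 1 → k ≠ 0 → 0 ≤ s → β ∈ Set.Icc (ν / |(k : ℝ)|) 1 → ℓ ∈ Set.Icc (2 : ℝ) 4 →
        0 < T →
        MeasureTheory.MemLp ξ 2 (MeasureTheory.volume.restrict (Set.Icc 0 T)) →
        (∀ t ∈ Set.Icc 0 T, lowerBound C β ν k s t ≤ ξ t ∧ ξ t ≤ upperBound ν s ℓ t) →
        IsWeakSolution ν k T ξ v Θ₀ Θ →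
        ∀ t ∈ Set.Icc 0 T,
          ‖Θ t‖ ^ 2 ≤ Ced * (1 + (|(k : ℝ)| / ν) ^ (1 / 2 : ℝ)) *
            Real.exp (-(1 / 4) * (β * ν * |(k : ℝ)|) ^ (1 / 2 : ℝ) *
                (∫ τ in (0 : ℝ)..t, ξ τ ^ (1 / 2 : ℝ) * weight ν s τ)
              - 2 * ν * (k : ℝ) ^ 2 * t) * ‖Θ₀‖ ^ 2 := by
  obtain ⟨v₀, v₁, v₂, hv₀, H₀, H₁, hfin, hs⟩ := hv.exists_derivatives
  obtain ⟨K, hK, hint⟩ := exists_interpolation H₁ hfin hs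
  have hK0 : 0 < K := by linarith
  have hC0 : 0 < max (8 * K) (136 * K ^ 3 * ‖v₂‖ ^ 2) := lt_max_of_lt_left (by positivity)
  -- The entry 8K of C serves the conditions r c ≤ bξ and r a ≤ ν; the other, with 136 = 17 · 8,
  -- makes the v'' terms perturbative. Both depend on v alone.
  refine ⟨max (8 * K) (136 * K ^ 3 * ‖v₂‖ ^ 2), hC0,
    4 * Real.exp (1 / 4) * (1 + 6 * K ^ 3 * ‖v₁‖ ^ 2), by positivity, ?_⟩
  intro ν k s β ℓ T ξ Θ₀ Θ hν hν1 hk _ hβ hℓ hT hξ2 hbd hsol t ht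
  have hρ : 0 < ν ^ s := Real.rpow_pos_of_pos hν s
  have hadm : ∀ t ∈ Icc 0 T, Admissible _ ν |(k : ℝ)| β ℓ (ξ t) (1 + ν ^ s * t) := fun t ht =>
    admissible_of_bounds hC0 hν hν1 hk hβ hℓ hT hbd ht
  have hξ : ∀ t ∈ Icc 0 T, 0 ≤ ξ t ∧ ξ t ≤ (1 + ν ^ s * T) ^ ℓ := fun t ht =>
    ⟨(hadm t ht).x_pos.le, (hadm t ht).x_le.trans
      (Real.rpow_le_rpow (hadm t ht).q_pos.le
        (by have := mul_le_mul_of_nonneg_left ht.2 hρ.le; linarith) (by linarith [hℓ.1]))⟩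
  have hξm := hξ2.aestronglyMeasurable
  obtain ⟨W, hW⟩ := truncated_decay (v₀ := v₀) (k := (k : ℝ)) H₁ hT.le hsol.continuousOn hρ.le hξm hK
    (le_max_left _ _) (le_max_right _ _) hint hadm hξ
  obtain ⟨D, hD, hDw, -⟩ := hsol.equation
  have hlim := tendsto_integral_forcing H₀ hT.le hsol.continuousOn hD hDw
  set R := ∫ τ in (0 : ℝ)..t, decayRate ν |(k : ℝ)| β (ξ τ) (1 + ν ^ s * τ) with hR
  have hfinal : ‖Θ t‖ ^ 2 * Real.exp (2 * ν * (k : ℝ) ^ 2 * t) * Real.exp (1 / 4 * R) ≤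
      2 * Real.exp (1 / 4) * (1 + (1 + 6 * K ^ 3 * ‖v₁‖ ^ 2 * √(|(k : ℝ)| / ν))) * ‖Θ₀‖ ^ 2
        + W * 0 := by
    -- The truncation is removed here: P_S tends strongly to the identity and the error integral
    -- vanishes.
    refine le_of_tendsto_of_tendsto (b := atTop)
      ((((tendsto_proj (Θ t)).norm.pow 2).mul_const _).mul_const _)
      ((((tendsto_proj Θ₀).norm.pow 2).const_mul _).add (hlim.const_mul W))
      (Eventually.of_forall fun S => ?_)
    obtain ⟨Ku, hKu⟩ := hsol.exists_lipschitzOnWith_proj hv₀ hT.le hξm hξ S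
    have := hW S Ku hKu (hsol.ae_hasDerivAt_proj hv₀ hT.le hξm hξ S) t ht
    rwa [hsol.initial] at this
  have hRint : R = (β * ν * |(k : ℝ)|) ^ (1 / 2 : ℝ) *
      ∫ τ in (0 : ℝ)..t, ξ τ ^ (1 / 2 : ℝ) * weight ν s τ := by
    rw [hR, ← intervalIntegral.integral_const_mul]
    simp only [decayRate, weight, Real.sqrt_eq_rpow]
  have hexp : Real.exp (-(1 / 4) * (β * ν * |(k : ℝ)|) ^ (1 / 2 : ℝ) *
      (∫ τ in (0 : ℝ)..t, ξ τ ^ (1 / 2 : ℝ) * weight ν s τ) - 2 * ν * (k : ℝ) ^ 2 * t)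
      = (Real.exp (2 * ν * (k : ℝ) ^ 2 * t) * Real.exp (1 / 4 * R))⁻¹ := by
    rw [← Real.exp_add, ← Real.exp_neg, hRint]
    congr 1
    ring
  rw [hexp, ← Real.sqrt_eq_rpow, mul_right_comm, ← div_eq_mul_inv, le_div_iff₀ (by positivity),
    ← mul_assoc]
  refine hfinal.trans ?_
  rw [mul_zero, add_zero]
  refine mul_le_mul_of_nonneg_right ?_ (by positivity)
  have h1 : 0 ≤ 6 * K ^ 3 * ‖v₁‖ ^ 2 := by positivity
  have h2 : 0 ≤ √(|(k : ℝ)| / ν) := Real.sqrt_nonneg _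
  have h3 : 1 + (1 + 6 * K ^ 3 * ‖v₁‖ ^ 2 * √(|(k : ℝ)| / ν)) ≤
      2 * ((1 + 6 * K ^ 3 * ‖v₁‖ ^ 2) * (1 + √(|(k : ℝ)| / ν))) := by
    have := mul_nonneg h1 h2
    linarith
  have h4 := mul_le_mul_of_nonneg_left h3 (by positivity : 0 ≤ 2 * Real.exp (1 / 4))
  linarith

end MainTheorem
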